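/- Let $\mathbb{D}=\{|z|<1\}\subset\mathbb{C}$, $\mathbb{T}=\partial\mathbb{D}$, $\overline{\mathbb D}=\mathbb D\cup\mathbb T$. Write $f_{\overline z}=\frac12(f_x+if_y)$ and, for a continuous function $u$ on $\mathbb{T}$ and $z\in\mathbb{D}$, let $$\mathcal{P}_u(z)=\frac1{2\pi}\int_0^{2\pi}\frac{1-|z|^2}{|1-ze^{-it}|^2}\,u(e^{it})\,dt$$ be its Poisson integral. For a bounded function $h$ on $\mathbb{D}$ put $\|h\|_\infty=\sup_{z\in\mathbb{D}}|h(z)|$. Let $g\in C(\overline{\mathbb{D}})$ and $\varphi\in C(\mathbb{T})$ be complex-valued, and let $f\in C^4(\mathbb{D})\cap C(\overline{\mathbb{D}})$ be a complex-valued function with $\Delta(\Delta f)=g$ in $\mathbb{D}$, with boundary values $f=f^*$ on $\mathbb{T}$ (that is, $f^*=f|_{\mathbb T}$), and with $f_{\overline z}=\varphi$ on $\mathbb{T}$, in the sense that $f_{\overline z}(z)\to\varphi(\zeta)$ as $z\to\zeta$, $z\in\mathbb{D}$, for every $\zeta\in\mathbb{T}$. Put $\varphi_1(e^{it})=\varphi(e^{it})e^{-it}$.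 Then for every $z\in\overline{\mathbb{D}}$, $$\left|f(z)-\frac{1-|z|^2}{1+|z|^2}\mathcal{P}_{f^*}(0)+\frac{(1-|z|^2)^2}{1+|z|^2}\mathcal{P}_{\varphi_1}(0)\right|$$ $$\le\frac4\pi\|\mathcal{P}_{f^*}\|_\infty\arctan|z|+\frac{4}{\pi}\|\mathcal{P}_{\varphi_1}\|_\infty(1-|z|^2)\arctan|z|+\|\mathcal{P}_{|f^*|}\|_\infty|z|+\frac1{64}\|g\|_\infty(1-|z|^2)^2.$$ Moreover, the inequality is sharp: for every constant $M>0$, the function $f(z)=\frac{M}{64}(1-|z|^2)^2$ satisfies these hypotheses with $g\equiv M$, $\varphi\equiv0$, $f^*\equiv0$, and for it equality holds at every $z\in\overline{\mathbb{D}}$. -/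

import Mathlib

open Real Set Filter Topology Metric
open scoped ComplexConjugate Laplacian InnerProductSpace

noncomputable section

/-- The Wirtinger derivative `f_{z̄} = (f_x + i f_y) / 2`. -/
def dzbar (f : ℂ → ℂ) (z : ℂ) : ℂ :=
  (fderiv ℝ f z 1 + Complex.I * fderiv ℝ f z Complex.I) / 2

/-- The Poisson integral over the unit circle,
`(1 / 2π) ∫₀^{2π} (1 - |z|²) / |1 - z e^{-it}|² • u (e^{it}) dt`; only the values of `u` on the unit
circle matter. -/
def poissonIntegral {E : Type*} [NormedAddCommGroup E] [NormedSpace ℝ E] (u : ℂ → E) (z : ℂ) : E :=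
  circleAverage (fun ζ => poissonKernel 0 z ζ • u ζ) 0 1

/-- The supremum norm over the open unit disk. -/
def discSup {E : Type*} [NormedAddCommGroup E] (u : ℂ → E) : ℝ :=
  ⨆ z : ball (0 : ℂ) 1, ‖u z‖

/-- The function `φ₁ (e^{it}) = φ (e^{it}) e^{-it}` on the unit circle. -/
def phiOne (φ : ℂ → ℂ) (ζ : ℂ) : ℂ := φ ζ * conj ζ

/-- `f ∈ C⁴(𝔻) ∩ C(𝔻̄)` solves `Δ(Δ f) = g` in `𝔻` with boundary values `f = f*` and `f_{z̄} = φ`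
on the unit circle, where `g ∈ C(𝔻̄)` and `φ ∈ C(𝕋)`. As `f` need not be differentiable at boundary
points, the condition on `f_{z̄}` is on its limits from inside the disk. -/
structure SolvesBiharmonicDirichlet (g φ fstar f : ℂ → ℂ) : Prop where
  g_cont : ContinuousOn g (closedBall 0 1)
  φ_cont : ContinuousOn φ (sphere 0 1)
  f_contDiff : ContDiffOn ℝ 4 f (ball 0 1)
  f_cont : ContinuousOn f (closedBall 0 1)
  biharmonic : ∀ z ∈ ball (0 : ℂ) 1, Δ (Δ f) z = g z
  boundary_value : ∀ ζ ∈ sphere (0 : ℂ) 1, f ζ = fstar ζ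
  boundary_dzbar : ∀ ζ ∈ sphere (0 : ℂ) 1, Tendsto (dzbar f) (𝓝[ball 0 1] ζ) (𝓝 (φ ζ))

/-- The left-hand side of the Schwarz type inequality. -/
def schwarzLHS (φ fstar f : ℂ → ℂ) (z : ℂ) : ℝ :=
  ‖f z - (((1 - ‖z‖ ^ 2) / (1 + ‖z‖ ^ 2) : ℝ) : ℂ) * poissonIntegral fstar 0
    + (((1 - ‖z‖ ^ 2) ^ 2 / (1 + ‖z‖ ^ 2) : ℝ) : ℂ) * poissonIntegral (phiOne φ) 0‖

/-- The right-hand side of the Schwarz type inequality. -/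
def schwarzRHS (g φ fstar : ℂ → ℂ) (z : ℂ) : ℝ :=
  4 / π * discSup (poissonIntegral fstar) * arctan ‖z‖
    + 4 * discSup (poissonIntegral (phiOne φ)) / π * (1 - ‖z‖ ^ 2) * arctan ‖z‖
    + discSup (poissonIntegral fun ζ => ‖fstar ζ‖) * ‖z‖
    + 1 / 64 * discSup g * (1 - ‖z‖ ^ 2) ^ 2

end

/-! With `∂ = dz` and `∂̄ = dzbar`, the bilaplacian is `16 ∂∂∂̄∂̄`. The core is a comparison
principle at the centre of the disk. If `Re Δ²v ≥ 0`, then integrating the radial means of `v`, `z̄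
∂̄v`, `∂∂̄v` and `z̄ ∂̄∂∂̄v` against one another shows that `v(0)`, minus the contribution of the
boundary values of `v` and `∂̄v`, has nonnegative real part (`re_dirichlet_defect_nonneg`). Applied
to `w - c u` with a suitable constant `c`, this bounds the defect of `u` by that of `w` whenever
`|Δ²u| ≤ Re Δ²w` (`norm_dirichlet_defect_le`).

A disk automorphism, with the weight `|1 + ā w|²`, multiplies the bilaplacian by a positive factor
(`bilaplacian_mobiusPullback`), so the comparison holds at every point `a`. The comparison function
is `K (1 - |z|²)² / 64`, whose bilaplacian is `K` and whose boundary data vanish. No Green function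
is computed. Dilations `f(sz)`, `s → 1`, remove the assumption of smoothness up to the circle. The
result is that `f(a)` differs from the Poisson integral at `a` of `dirichletDatum` by at most `‖g‖
(1 - |a|²)² / 64`.

That Poisson integral splits into `P_{f*}(a)`, a term carrying a multiplier of modulus `|a|`, and
`-(1 - |a|²) P_{φ₁}(a)`. The first and last are controlled by the harmonic Schwarz lemma
(`norm_poissonIntegral_sub_le`), which comes from the exact L¹ distance between the Poisson kernel
and the constant `(1 - |a|²)/(1 + |a|²)`; the middle one gives the term with `P_{|f*|}`. The
comparison function itself is the extremal one. -/

noncomputable section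

/-! ### Wirtinger calculus and the bilaplacian -/

/-- The Wirtinger derivative `f_z = (f_x - i f_y) / 2`. -/
def dz (f : ℂ → ℂ) (z : ℂ) : ℂ :=
  (fderiv ℝ f z 1 - Complex.I * fderiv ℝ f z Complex.I) / 2

/-- The real linear map `h ↦ p h + q h̄`. -/
def wirtingerCLM (p q : ℂ) : ℂ →L[ℝ] ℂ :=
  p • ContinuousLinearMap.id ℝ ℂ + q • (Complex.conjCLE : ℂ →L[ℝ] ℂ)

@[simp] theorem wirtingerCLM_apply (p q h : ℂ) : wirtingerCLM p q h = p * h + q * conj h := by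
  simp [wirtingerCLM]

/-- `f` is real differentiable at `z` with Wirtinger derivatives `f_z = p` and `f_z̄ = q`. -/
def HasWirtingerAt (f : ℂ → ℂ) (p q z : ℂ) : Prop := HasFDerivAt f (wirtingerCLM p q) z

theorem fderiv_eq_wirtingerCLM (f : ℂ → ℂ) (z : ℂ) :
    fderiv ℝ f z = wirtingerCLM (dz f z) (dzbar f z) := by
  ext h
  have hh : h = (h.re : ℝ) • (1 : ℂ) + (h.im : ℝ) • Complex.I := by
    simp [Complex.re_add_im]
  rw [wirtingerCLM_apply]
  conv_lhs => rw [hh, map_add, map_smul, map_smul]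
  simp only [dz, dzbar]
  generalize fderiv ℝ f z 1 = A
  generalize fderiv ℝ f z Complex.I = B
  apply Complex.ext <;> simp <;> ring

theorem DifferentiableAt.hasWirtingerAt {f : ℂ → ℂ} {z : ℂ} (h : DifferentiableAt ℝ f z) :
    HasWirtingerAt f (dz f z) (dzbar f z) z := by
  rw [HasWirtingerAt, ← fderiv_eq_wirtingerCLM]
  exact h.hasFDerivAt

namespace HasWirtingerAt

variable {f g : ℂ → ℂ} {p q p' q' z : ℂ}

theorem dz_eq (h : HasWirtingerAt f p q z) : dz f z = p := by
  rw [dz, HasFDerivAt.fderiv h]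
  simp only [wirtingerCLM_apply, map_one, Complex.conj_I]
  linear_combination (-(1 / 2) * (p - q)) * Complex.I_mul_I

theorem dzbar_eq (h : HasWirtingerAt f p q z) : dzbar f z = q := by
  rw [dzbar, HasFDerivAt.fderiv h]
  simp only [wirtingerCLM_apply, map_one, Complex.conj_I]
  linear_combination (1 / 2 * (p - q)) * Complex.I_mul_I

theorem congr_deriv (h : HasWirtingerAt f p q z) (hp : p = p') (hq : q = q') :
    HasWirtingerAt f p' q' z := hp ▸ hq ▸ h

theorem congr_of_eventuallyEq (h : HasWirtingerAt f p q z) (hg : g =ᶠ[𝓝 z] f) :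
    HasWirtingerAt g p q z := HasFDerivAt.congr_of_eventuallyEq h hg

theorem const (c z : ℂ) : HasWirtingerAt (fun _ => c) 0 0 z := by
  have : wirtingerCLM 0 0 = 0 := by ext h; simp
  rw [HasWirtingerAt, this]
  exact hasFDerivAt_const c z

theorem of_hasDerivAt {d : ℂ} (h : HasDerivAt f d z) : HasWirtingerAt f d 0 z := by
  refine (h.hasFDerivAt.restrictScalars ℝ).congr_fderiv ?_
  ext h; simp [mul_comm]

theorem id (z : ℂ) : HasWirtingerAt (fun w => w) 1 0 z := of_hasDerivAt (hasDerivAt_id z)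

theorem star (h : HasWirtingerAt f p q z) :
    HasWirtingerAt (fun w => conj (f w)) (conj q) (conj p) z := by
  refine ((Complex.conjCLE : ℂ →L[ℝ] ℂ).hasFDerivAt.comp z h).congr_fderiv ?_
  ext h; simp [add_comm]

theorem conj_id (z : ℂ) : HasWirtingerAt (fun w => conj w) 0 1 z :=
  (HasWirtingerAt.id z).star.congr_deriv (by simp) (by simp)

theorem add (hf : HasWirtingerAt f p q z) (hg : HasWirtingerAt g p' q' z) :
    HasWirtingerAt (fun w => f w + g w) (p + p') (q + q') z := by
  refine (HasFDerivAt.add hf hg).congr_fderiv ?_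
  ext h; simp; ring

theorem sub (hf : HasWirtingerAt f p q z) (hg : HasWirtingerAt g p' q' z) :
    HasWirtingerAt (fun w => f w - g w) (p - p') (q - q') z := by
  refine (HasFDerivAt.sub hf hg).congr_fderiv ?_
  ext h; simp; ring

theorem mul (hf : HasWirtingerAt f p q z) (hg : HasWirtingerAt g p' q' z) :
    HasWirtingerAt (fun w => f w * g w) (p * g z + f z * p') (q * g z + f z * q') z := by
  refine (HasFDerivAt.mul hf hg).congr_fderiv ?_
  ext h; simp; ring

theorem const_mul (c : ℂ) (hf : HasWirtingerAt f p q z) :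
    HasWirtingerAt (fun w => c * f w) (c * p) (c * q) z :=
  ((const c z).mul hf).congr_deriv (by simp) (by simp)

theorem comp_hasDerivAt {φ : ℂ → ℂ} {d w : ℂ} (hf : HasWirtingerAt f p q (φ w))
    (hφ : HasDerivAt φ d w) :
    HasWirtingerAt (fun w => f (φ w)) (p * d) (q * conj d) w := by
  refine (HasFDerivAt.comp w hf (of_hasDerivAt hφ)).congr_fderiv ?_
  ext h; simp; ring

end HasWirtingerAt

theorem Filter.EventuallyEq.dz_eq {f g : ℂ → ℂ} {z : ℂ} (h : f =ᶠ[𝓝 z] g) : dz f z = dz g z := by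
  rw [dz, dz, h.fderiv_eq]

theorem Filter.EventuallyEq.dzbar_eq {f g : ℂ → ℂ} {z : ℂ} (h : f =ᶠ[𝓝 z] g) :
    dzbar f z = dzbar g z := by
  rw [dzbar, dzbar, h.fderiv_eq]

theorem Filter.EventuallyEq.dz {f g : ℂ → ℂ} {z : ℂ} (h : f =ᶠ[𝓝 z] g) :
    dz f =ᶠ[𝓝 z] dz g := h.eventuallyEq_nhds.mono fun _ hw => hw.dz_eq

theorem Filter.EventuallyEq.dzbar {f g : ℂ → ℂ} {z : ℂ} (h : f =ᶠ[𝓝 z] g) :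
    dzbar f =ᶠ[𝓝 z] dzbar g := h.eventuallyEq_nhds.mono fun _ hw => hw.dzbar_eq

theorem ContDiffAt.dz {f : ℂ → ℂ} {z : ℂ} {m n : WithTop ℕ∞} (h : ContDiffAt ℝ n f z)
    (hmn : m + 1 ≤ n) : ContDiffAt ℝ m (dz f) z := by
  have h1 := h.fderiv_right hmn
  exact ((h1.clm_apply contDiffAt_const).sub
    (contDiffAt_const.mul (h1.clm_apply contDiffAt_const))).div_const 2

theorem ContDiffAt.dzbar {f : ℂ → ℂ} {z : ℂ} {m n : WithTop ℕ∞} (h : ContDiffAt ℝ n f z)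
    (hmn : m + 1 ≤ n) : ContDiffAt ℝ m (dzbar f) z := by
  have h1 := h.fderiv_right hmn
  exact ((h1.clm_apply contDiffAt_const).add
    (contDiffAt_const.mul (h1.clm_apply contDiffAt_const))).div_const 2

theorem fderiv_dzbar_apply {f : ℂ → ℂ} {z : ℂ} (h : ContDiffAt ℝ 2 f z) (v : ℂ) :
    fderiv ℝ (dzbar f) z v =
      (fderiv ℝ (fderiv ℝ f) z v 1 + Complex.I * fderiv ℝ (fderiv ℝ f) z v Complex.I) / 2 := by
  have h1 : HasFDerivAt (fderiv ℝ f) (fderiv ℝ (fderiv ℝ f) z) z :=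
    ((h.fderiv_right (m := 1) (by norm_num)).differentiableAt (by norm_num)).hasFDerivAt
  have h2 := (((h1.clm_apply (hasFDerivAt_const (1 : ℂ) z)).add
    ((h1.clm_apply (hasFDerivAt_const Complex.I z)).const_mul Complex.I)).mul_const (2⁻¹ : ℂ))
  have h3 : HasFDerivAt (dzbar f) _ z := h2.congr_of_eventuallyEq
    (Eventually.of_forall fun w => by simp [dzbar, div_eq_mul_inv])
  rw [h3.fderiv]
  simp; ring

theorem fderiv_dz_apply {f : ℂ → ℂ} {z : ℂ} (h : ContDiffAt ℝ 2 f z) (v : ℂ) :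
    fderiv ℝ (dz f) z v =
      (fderiv ℝ (fderiv ℝ f) z v 1 - Complex.I * fderiv ℝ (fderiv ℝ f) z v Complex.I) / 2 := by
  have h1 : HasFDerivAt (fderiv ℝ f) (fderiv ℝ (fderiv ℝ f) z) z :=
    ((h.fderiv_right (m := 1) (by norm_num)).differentiableAt (by norm_num)).hasFDerivAt
  have h2 := (((h1.clm_apply (hasFDerivAt_const (1 : ℂ) z)).sub
    ((h1.clm_apply (hasFDerivAt_const Complex.I z)).const_mul Complex.I)).mul_const (2⁻¹ : ℂ))
  have h3 : HasFDerivAt (dz f) _ z := h2.congr_of_eventuallyEq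
    (Eventually.of_forall fun w => by simp [dz, div_eq_mul_inv])
  rw [h3.fderiv]
  simp; ring

theorem laplacian_eq_dz_dzbar {f : ℂ → ℂ} {z : ℂ} (h : ContDiffAt ℝ 2 f z) :
    Δ f z = 4 * dz (dzbar f) z := by
  have hs : IsSymmSndFDerivAt ℝ f z := h.isSymmSndFDerivAt (by simp)
  rw [InnerProductSpace.laplacian_eq_iteratedFDeriv_complexPlane, dz, fderiv_dzbar_apply h,
    fderiv_dzbar_apply h, hs.eq Complex.I 1]
  simp only [iteratedFDeriv_two_apply, Matrix.cons_val_zero, Matrix.cons_val_one]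
  linear_combination ((fderiv ℝ (fderiv ℝ f) z Complex.I) Complex.I) * Complex.I_mul_I

theorem dzbar_dz_comm {f : ℂ → ℂ} {z : ℂ} (h : ContDiffAt ℝ 2 f z) :
    dzbar (dz f) z = dz (dzbar f) z := by
  have hs : IsSymmSndFDerivAt ℝ f z := h.isSymmSndFDerivAt (by simp)
  rw [dz, dzbar, fderiv_dzbar_apply h, fderiv_dz_apply h, fderiv_dzbar_apply h,
    fderiv_dz_apply h, hs.eq Complex.I 1]
  ring

/-- The inner pair commutes on a whole neighbourhood, so the outer derivatives agree. Radial means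
produce the alternating order, while the Möbius computation needs both `∂̄` taken first. -/
theorem dz_dzbar_dz_dzbar {f : ℂ → ℂ} {z : ℂ} (h : ContDiffAt ℝ 4 f z) :
    dz (dzbar (dz (dzbar f))) z = dz (dz (dzbar (dzbar f))) z := by
  have h3 : ContDiffAt ℝ 3 (dzbar f) z := h.dzbar (by norm_num)
  refine Filter.EventuallyEq.dz_eq ?_
  filter_upwards [h3.eventually (by simp)] with w hw
  exact dzbar_dz_comm (hw.of_le (by norm_num))

theorem laplacian_laplacian_eq {f : ℂ → ℂ} {z : ℂ} (h : ContDiffAt ℝ 4 f z) :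
    Δ (Δ f) z = 16 * dz (dz (dzbar (dzbar f))) z := by
  have h3 : ContDiffAt ℝ 3 (dzbar f) z := h.dzbar (by norm_num)
  have h2 : ContDiffAt ℝ 2 (dz (dzbar f)) z := h3.dz (by norm_num)
  have h0 : Δ f =ᶠ[𝓝 z] (4 : ℂ) • dz (dzbar f) := by
    filter_upwards [h.eventually (by simp)] with w hw
    simpa using laplacian_eq_dz_dzbar (hw.of_le (by norm_num))
  rw [InnerProductSpace.laplacian_congr_nhds h0 |>.eq_of_nhds,
    InnerProductSpace.laplacian_smul _ h2, laplacian_eq_dz_dzbar h2, dz_dzbar_dz_dzbar h]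
  simp only [smul_eq_mul]; ring

/-! ### Radial derivatives of circle means and the comparison principle -/

theorem circleAverage_const_mul (c : ℂ) (f : ℂ → ℂ) (r : ℝ) :
    circleAverage (fun z => c * f z) 0 r = c * circleAverage f 0 r :=
  circleAverage_fun_smul (a := c)

theorem CircleIntegrable.mul_left {f : ℂ → ℂ} {r : ℝ} (c : ℂ) (hf : CircleIntegrable f 0 r) :
    CircleIntegrable (fun z => c * f z) 0 r := hf.const_smul (a := c)

theorem hasDerivAt_circleMap_radius (t r : ℝ) :
    HasDerivAt (fun s : ℝ => circleMap 0 s t) (Complex.exp (t * Complex.I)) r := by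
  have h : HasDerivAt (fun s : ℝ => (s : ℂ) * Complex.exp (t * Complex.I))
      (1 * Complex.exp (t * Complex.I)) r :=
    (Complex.ofRealCLM.hasDerivAt (x := r)).mul_const _
  simpa [circleMap] using h

theorem continuousOn_dz {F : ℂ → ℂ} {s : Set ℂ} (hF : ∀ z ∈ s, ContDiffAt ℝ 1 F z) :
    ContinuousOn (dz F) s := fun z hz =>
  ((hF z hz).dz (m := 0) (by norm_num)).continuousAt.continuousWithinAt

theorem continuousOn_dzbar {F : ℂ → ℂ} {s : Set ℂ} (hF : ∀ z ∈ s, ContDiffAt ℝ 1 F z) :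
    ContinuousOn (dzbar F) s := fun z hz =>
  ((hF z hz).dzbar (m := 0) (by norm_num)).continuousAt.continuousWithinAt

section RadialDerivative

variable {F : ℂ → ℂ} {r R : ℝ}

theorem sphere_subset_ball_of_lt (hrR : r < R) : sphere (0 : ℂ) r ⊆ ball 0 R := fun z hz => by
  simp_all

/-- `i (z ∂F - z̄ ∂̄F)` is the angular derivative of `F`, so its integral over a full circle is
zero. -/
theorem circleAverage_mul_dz_eq (hF : ∀ z ∈ ball (0 : ℂ) R, ContDiffAt ℝ 1 F z) (hr : 0 ≤ r)
    (hrR : r < R) :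
    circleAverage (fun z => z * dz F z) 0 r =
      circleAverage (fun z => conj z * dzbar F z) 0 r := by
  have hsub := sphere_subset_ball_of_lt hrR
  have hF' : ∀ z ∈ sphere (0 : ℂ) r, ContDiffAt ℝ 1 F z := fun z hz => hF z (hsub hz)
  have c1 : ContinuousOn (fun z => z * dz F z) (sphere 0 r) :=
    continuousOn_id.mul (continuousOn_dz hF')
  have c2 : ContinuousOn (fun z => conj z * dzbar F z) (sphere 0 r) :=
    Complex.continuous_conj.continuousOn.mul (continuousOn_dzbar hF')
  have i1 := c1.circleIntegrable hr
  have i2 := c2.circleIntegrable hr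
  rw [← sub_eq_zero, ← circleAverage_fun_sub i1 i2, circleAverage_def]
  have key : ∀ t : ℝ, HasDerivAt (fun t : ℝ => F (circleMap 0 r t))
      (Complex.I * (circleMap 0 r t * dz F (circleMap 0 r t) -
        conj (circleMap 0 r t) * dzbar F (circleMap 0 r t))) t := by
    intro t
    have h1 : HasFDerivAt F _ (circleMap 0 r t) :=
      ((hF' _ (circleMap_mem_sphere 0 hr t)).differentiableAt (by norm_num)).hasWirtingerAt
    refine (h1.comp_hasDerivAt t (hasDerivAt_circleMap 0 r t)).congr_deriv ?_
    simp only [wirtingerCLM_apply, map_mul, Complex.conj_I]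
    ring
  have h2 : IntervalIntegrable (fun t : ℝ => Complex.I * (circleMap 0 r t * dz F (circleMap 0 r t) -
        conj (circleMap 0 r t) * dzbar F (circleMap 0 r t))) MeasureTheory.volume 0 (2 * π) :=
    (IntervalIntegrable.sub i1 i2).const_mul _
  have h3 := intervalIntegral.integral_eq_sub_of_hasDerivAt (fun t _ => key t) h2
  rw [intervalIntegral.integral_const_mul] at h3
  have h4 : circleMap 0 r (2 * π) = circleMap 0 r 0 := by simp [circleMap]
  rw [h4, sub_self] at h3
  rw [(mul_eq_zero.mp h3).resolve_left Complex.I_ne_zero, smul_zero]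

/-- Differentiating under the integral gives the mean of `(z ∂F + z̄ ∂̄F) / r`, and the two summands
have equal means. -/
theorem hasDerivAt_circleAverage (hF : ∀ z ∈ ball (0 : ℂ) R, ContDiffAt ℝ 1 F z) (hr : 0 < r)
    (hrR : r < R) :
    HasDerivAt (circleAverage F 0)
      ((2 / r) • circleAverage (fun z => conj z * dzbar F z) 0 r) r := by
  obtain ⟨R', hrR', hR'⟩ := exists_between hrR
  have hsub := sphere_subset_ball_of_lt hrR
  have hcb : closedBall (0 : ℂ) R' ⊆ ball 0 R := closedBall_subset_ball hR'
  have hF' : ∀ z ∈ sphere (0 : ℂ) r, ContDiffAt ℝ 1 F z := fun z hz => hF z (hsub hz)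
  have c1 : ContinuousOn (fun z => z * dz F z) (sphere 0 r) :=
    continuousOn_id.mul (continuousOn_dz hF')
  have c2 : ContinuousOn (fun z => conj z * dzbar F z) (sphere 0 r) :=
    Complex.continuous_conj.continuousOn.mul (continuousOn_dzbar hF')
  have i1 := c1.circleIntegrable hr.le
  have i2 := c2.circleIntegrable hr.le
  have cF : ContinuousOn F (ball 0 R) := fun z hz => (hF z hz).continuousAt.continuousWithinAt
  have cfd : ContinuousOn (fderiv ℝ F) (closedBall 0 R') := fun z hz =>
    ((hF z (hcb hz)).fderiv_right (m := 0) (by norm_num)).continuousAt.continuousWithinAt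
  obtain ⟨C, hC⟩ := (isCompact_closedBall (0 : ℂ) R').exists_bound_of_continuousOn cfd
  have hs : Ioo 0 R' ∈ 𝓝 r := Ioo_mem_nhds hr hrR'
  have hmem : ∀ x ∈ Ioo 0 R', ∀ t, circleMap 0 x t ∈ closedBall (0 : ℂ) R' := by
    intro x hx t
    simp [circleMap, abs_of_pos hx.1, hx.2.le]
  have hexp : ∀ t : ℝ, (r : ℂ) * Complex.exp (t * Complex.I) = circleMap 0 r t := by
    intro t; simp [circleMap]
  have main := (intervalIntegral.hasDerivAt_integral_of_dominated_loc_of_deriv_le (𝕜 := ℝ)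
    (F := fun x t => F (circleMap 0 x t))
    (F' := fun x t => fderiv ℝ F (circleMap 0 x t) (Complex.exp (t * Complex.I)))
    (bound := fun _ => C) (a := 0) (b := 2 * π) (μ := MeasureTheory.volume) hs ?_ ?_ ?_ ?_ ?_ ?_).2
  · refine (main.const_smul (2 * π)⁻¹).congr_deriv ?_
    have : (2 / r) • circleAverage (fun z => conj z * dzbar F z) 0 r =
        (1 / r) • (circleAverage (fun z => z * dz F z + conj z * dzbar F z) 0 r) := by
      rw [circleAverage_fun_add i1 i2, circleAverage_mul_dz_eq hF hr.le hrR, ← two_smul ℝ,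
        smul_smul]
      congr 1; ring
    rw [this, circleAverage_def, smul_comm (1 / r), ← intervalIntegral.integral_smul (1 / r)]
    refine congrArg (fun x : ℂ => (2 * π)⁻¹ • x) (intervalIntegral.integral_congr fun t _ => ?_)
    rw [fderiv_eq_wirtingerCLM, wirtingerCLM_apply, ← hexp t]
    have : (r : ℂ) ≠ 0 := by exact_mod_cast hr.ne'
    simp only [Complex.real_smul, map_mul, Complex.conj_ofReal]
    push_cast
    field_simp
  · filter_upwards [hs] with x hx
    refine (Continuous.aestronglyMeasurable ?_)
    exact (cF.mono hcb).comp_continuous (continuous_circleMap 0 x) (hmem x hx)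
  · exact ((cF.mono hsub).circleIntegrable hr.le)
  · refine (Continuous.aestronglyMeasurable ?_)
    exact (cfd.comp_continuous (continuous_circleMap 0 r) (hmem r ⟨hr, hrR'⟩)).clm_apply
      (by fun_prop)
  · refine Eventually.of_forall fun t _ x hx => ?_
    refine (ContinuousLinearMap.le_opNorm _ _).trans ?_
    rw [Complex.norm_exp_ofReal_mul_I, mul_one]
    exact hC _ (hmem x hx t)
  · exact intervalIntegrable_const
  · refine Eventually.of_forall fun t _ x hx => ?_
    exact ((hF _ (hcb (hmem x hx t))).differentiableAt (by norm_num)).hasFDerivAt.comp_hasDerivAt x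
      (hasDerivAt_circleMap_radius t x)

theorem continuousOn_circleAverage {F : ℂ → ℂ} (hF : ContinuousOn F (ball 0 R)) :
    ContinuousOn (circleAverage F 0) (Ico 0 R) :=
  ContinuousOn.circleAverage (hF.mono fun z hz => by simpa using hz.2) fun r hr => hr.1

/-- The radial derivative of the circle average of `z̄ F_z̄` in terms of `F_{z z̄}`. -/
theorem hasDerivAt_circleAverage_conj_mul_dzbar
    (hF : ∀ z ∈ ball (0 : ℂ) R, ContDiffAt ℝ 2 F z) (hr : 0 < r) (hrR : r < R) :
    HasDerivAt (circleAverage (fun z => conj z * dzbar F z) 0)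
      ((2 * r) • circleAverage (dz (dzbar F)) 0 r) r := by
  have hG : ∀ z ∈ ball (0 : ℂ) R, ContDiffAt ℝ 1 (fun z => conj z * dzbar F z) z := fun z hz =>
    Complex.conjCLE.contDiff.contDiffAt.mul ((hF z hz).dzbar (by norm_num))
  refine (hasDerivAt_circleAverage hG hr hrR).congr_deriv ?_
  -- With `G = z̄ ∂̄F`, trade `z̄ ∂̄G` for `z ∂G`: then `∂` passes through `z̄`, and `z z̄ = r²` is
  -- constant on the circle.
  rw [← circleAverage_mul_dz_eq hG hr.le hrR]
  have : (2 * r) • circleAverage (dz (dzbar F)) 0 r =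
      (2 / r) • circleAverage (fun z => ((r : ℂ) ^ 2) * dz (dzbar F) z) 0 r := by
    rw [circleAverage_const_mul]
    have : (r : ℂ) ≠ 0 := by exact_mod_cast hr.ne'
    simp only [Complex.real_smul]
    push_cast
    field_simp
  rw [this]
  congr 1
  refine circleAverage_congr_sphere fun z hz => ?_
  rw [abs_of_pos hr] at hz
  have h1 := ((hF z (sphere_subset_ball_of_lt hrR hz)).dzbar (m := 1) (by norm_num)).differentiableAt
    (by norm_num) |>.hasWirtingerAt
  have h2 := ((HasWirtingerAt.conj_id z).mul h1).dz_eq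
  simp only [h2]
  have : (r : ℂ) ^ 2 = z * conj z := by
    rw [Complex.mul_conj, Complex.normSq_eq_norm_sq]
    simp_all
  rw [this]; ring

/-- For `Re Δ²v ≥ 0`, the value at the centre is at least the boundary contribution
to the solution of the biharmonic Dirichlet problem. -/
theorem re_dirichlet_defect_nonneg {v : ℂ → ℂ} (hR : 1 < R)
    (hv : ∀ z ∈ ball (0 : ℂ) R, ContDiffAt ℝ 4 v z)
    (hpos : ∀ z ∈ closedBall (0 : ℂ) 1, 0 ≤ (dz (dz (dzbar (dzbar v))) z).re) :
    0 ≤ (v 0 - circleAverage v 0 1 + circleAverage (fun z => conj z * dzbar v z) 0 1).re := by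
  have hv2 : ∀ z ∈ ball (0 : ℂ) R, ContDiffAt ℝ 2 v z := fun z hz => (hv z hz).of_le (by norm_num)
  have hv1 : ∀ z ∈ ball (0 : ℂ) R, ContDiffAt ℝ 1 v z := fun z hz => (hv z hz).of_le (by norm_num)
  have hL : ∀ z ∈ ball (0 : ℂ) R, ContDiffAt ℝ 2 (dz (dzbar v)) z := fun z hz =>
    ((hv z hz).dzbar (m := 3) (by norm_num)).dz (by norm_num)
  have hL1 : ∀ z ∈ ball (0 : ℂ) R, ContDiffAt ℝ 1 (dz (dzbar v)) z := fun z hz =>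
    (hL z hz).of_le (by norm_num)
  have re_deriv : ∀ {f : ℝ → ℂ} {f' : ℂ} {x : ℝ}, HasDerivAt f f' x →
      HasDerivAt (fun x => (f x).re) f'.re x := fun h =>
    Complex.reCLM.hasFDerivAt.comp_hasDerivAt _ h
  -- The chain is `m' = 2p/r`, `p' = 2rn`, `n' = 2k/r`, and `k'` is `2r` times the mean of a
  -- nonnegative quantity. Since `p` and `k` vanish at `0`, positivity climbs from `k'` back to `(p
  -- - m)'`.
  set m : ℝ → ℝ := fun r => (circleAverage v 0 r).re with hm
  set p : ℝ → ℝ := fun r => (circleAverage (fun z => conj z * dzbar v z) 0 r).re with hp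
  set n : ℝ → ℝ := fun r => (circleAverage (dz (dzbar v)) 0 r).re with hn
  set k : ℝ → ℝ := fun r =>
    (circleAverage (fun z => conj z * dzbar (dz (dzbar v)) z) 0 r).re with hk
  have dm : ∀ r ∈ Ioo 0 R, HasDerivAt m (2 / r * p r) r := fun r hr => by
    simpa using re_deriv (hasDerivAt_circleAverage hv1 hr.1 hr.2)
  have dp : ∀ r ∈ Ioo 0 R, HasDerivAt p (2 * r * n r) r := fun r hr => by
    simpa using re_deriv (hasDerivAt_circleAverage_conj_mul_dzbar hv2 hr.1 hr.2)
  have dn : ∀ r ∈ Ioo 0 R, HasDerivAt n (2 / r * k r) r := fun r hr => by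
    simpa using re_deriv (hasDerivAt_circleAverage hL1 hr.1 hr.2)
  have dk : ∀ r ∈ Ioo 0 R, HasDerivAt k
      (2 * r * (circleAverage (dz (dzbar (dz (dzbar v)))) 0 r).re) r := fun r hr => by
    simpa using re_deriv (hasDerivAt_circleAverage_conj_mul_dzbar hL hr.1 hr.2)
  have csub : Icc 0 1 ⊆ Ico 0 R := fun x hx => ⟨hx.1, hx.2.trans_lt hR⟩
  have osub : ∀ x ∈ Ioo (0 : ℝ) 1, x ∈ Ioo 0 R := fun x hx => ⟨hx.1, hx.2.trans hR⟩
  have cre : ∀ {F : ℂ → ℂ}, ContinuousOn F (ball 0 R) →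
      ContinuousOn (fun r => (circleAverage F 0 r).re) (Icc 0 1) := fun hF =>
    Complex.continuous_re.comp_continuousOn ((continuousOn_circleAverage hF).mono csub)
  have cm : ContinuousOn m (Icc 0 1) := cre fun z hz =>
    (hv z hz).continuousAt.continuousWithinAt
  have cp : ContinuousOn p (Icc 0 1) :=
    cre (Complex.continuous_conj.continuousOn.mul (continuousOn_dzbar hv1))
  have cn : ContinuousOn n (Icc 0 1) := cre fun z hz =>
    (hL z hz).continuousAt.continuousWithinAt
  have ck : ContinuousOn k (Icc 0 1) :=
    cre (Complex.continuous_conj.continuousOn.mul (continuousOn_dzbar hL1))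
  have zero_mem : (0 : ℝ) ∈ Icc (0 : ℝ) 1 := ⟨le_rfl, zero_le_one⟩
  have one_mem : (1 : ℝ) ∈ Icc (0 : ℝ) 1 := ⟨zero_le_one, le_rfl⟩
  have mono : ∀ {f f' : ℝ → ℝ}, ContinuousOn f (Icc 0 1) →
      (∀ x ∈ Ioo (0 : ℝ) 1, HasDerivAt f (f' x) x) → (∀ x ∈ Ioo (0 : ℝ) 1, 0 ≤ f' x) →
      MonotoneOn f (Icc 0 1) := by
    intro f f' hc hd h0
    refine monotoneOn_of_deriv_nonneg (convex_Icc 0 1) hc ?_ ?_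
    · rw [interior_Icc]
      exact fun x hx => (hd x hx).differentiableAt.differentiableWithinAt
    · rw [interior_Icc]
      exact fun x hx => (hd x hx).deriv ▸ h0 x hx
  have k0 : k 0 = 0 := by simp [hk]
  have p0 : p 0 = 0 := by simp [hp]
  have hbi : ∀ r ∈ Ioo (0 : ℝ) 1, 0 ≤ (circleAverage (dz (dzbar (dz (dzbar v)))) 0 r).re := by
    intro r hr
    have hc : ContinuousOn (dz (dzbar (dz (dzbar v)))) (sphere 0 r) := fun z hz =>
      (((hL z (sphere_subset_ball_of_lt (osub r hr).2 hz)).dzbar (m := 1) (by norm_num)).dz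
        (m := 0) (by norm_num)).continuousAt.continuousWithinAt
    have h := Complex.reCLM.circleAverage_comp_comm (hc.circleIntegrable hr.1.le)
    rw [Complex.reCLM_apply] at h
    rw [← h]
    refine circleAverage_nonneg_of_nonneg fun z hz => ?_
    rw [abs_of_pos hr.1] at hz
    simp only [Function.comp, Complex.reCLM_apply]
    rw [dz_dzbar_dz_dzbar (hv z (sphere_subset_ball_of_lt (osub r hr).2 hz))]
    exact hpos z (by simp_all; linarith [hr.2])
  have mk := mono ck (fun x hx => dk x (osub x hx)) fun x hx =>
    mul_nonneg (mul_nonneg zero_le_two hx.1.le) (hbi x hx)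
  have hk0 : ∀ x ∈ Ioo (0 : ℝ) 1, 0 ≤ k x := fun x hx =>
    k0 ▸ mk zero_mem (Ioo_subset_Icc_self hx) hx.1.le
  have mn := mono cn (fun x hx => dn x (osub x hx)) fun x hx =>
    mul_nonneg (div_nonneg zero_le_two hx.1.le) (hk0 x hx)
  -- In effect `p(r) = ∫₀^r 2s n(s) ds ≤ r² n(r)`, because `n` is increasing; monotonicity of the
  -- difference replaces the integral.
  have hpn : ∀ r ∈ Ioo (0 : ℝ) 1, p r ≤ r ^ 2 * n r := by
    intro r hr
    have hsub : Icc 0 r ⊆ Icc (0 : ℝ) 1 := Icc_subset_Icc_right hr.2.le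
    have h : MonotoneOn (fun s => s ^ 2 * n r - p s) (Icc 0 r) := by
      have hd : ∀ s ∈ Ioo 0 r, HasDerivAt (fun s => s ^ 2 * n r - p s)
          (2 * s * (n r - n s)) s := fun s hs => by
        refine (((hasDerivAt_pow 2 s).mul_const (n r)).sub
          (dp s ⟨hs.1, hs.2.trans (osub r hr).2⟩)).congr_deriv ?_
        simp; ring
      refine monotoneOn_of_deriv_nonneg (convex_Icc 0 r)
        (ContinuousOn.sub (by fun_prop) (cp.mono hsub)) ?_ ?_
      · rw [interior_Icc]
        exact fun x hx => (hd x hx).differentiableAt.differentiableWithinAt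
      · rw [interior_Icc]
        intro x hx
        rw [(hd x hx).deriv]
        have := mn (hsub (Ioo_subset_Icc_self hx)) (Ioo_subset_Icc_self hr) hx.2.le
        exact mul_nonneg (mul_nonneg zero_le_two hx.1.le) (by linarith)
    have := h (left_mem_Icc.mpr hr.1.le) (right_mem_Icc.mpr hr.1.le) hr.1.le
    simp only [p0] at this
    linarith
  have mq : MonotoneOn (fun r => p r - m r) (Icc 0 1) := by
    refine mono (f' := fun r => 2 * r * n r - 2 / r * p r) (cp.sub cm)
      (fun x hx => (dp x (osub x hx)).sub (dm x (osub x hx))) fun x hx => ?_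
    have h1 := hpn x hx
    have h2 : 2 * x * n x - 2 / x * p x = 2 / x * (x ^ 2 * n x - p x) := by
      have := hx.1.ne'
      field_simp
    rw [h2]
    exact mul_nonneg (div_nonneg zero_le_two hx.1.le) (by linarith)
  have h := mq zero_mem one_mem zero_le_one
  have m0 : m 0 = (v 0).re := by simp [hm]
  simp only [p0, m0] at h
  simp only [Complex.add_re, Complex.sub_re]
  linarith

theorem dz_sub_const_mul {u w : ℂ → ℂ} {z : ℂ} (c : ℂ) (hw : DifferentiableAt ℝ w z)
    (hu : DifferentiableAt ℝ u z) :
    dz (fun z => w z - c * u z) z = dz w z - c * dz u z :=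
  (hw.hasWirtingerAt.sub (hu.hasWirtingerAt.const_mul c)).dz_eq

theorem dzbar_sub_const_mul {u w : ℂ → ℂ} {z : ℂ} (c : ℂ) (hw : DifferentiableAt ℝ w z)
    (hu : DifferentiableAt ℝ u z) :
    dzbar (fun z => w z - c * u z) z = dzbar w z - c * dzbar u z :=
  (hw.hasWirtingerAt.sub (hu.hasWirtingerAt.const_mul c)).dzbar_eq

theorem eventually_dz_sub_const_mul {u w : ℂ → ℂ} {z : ℂ} (c : ℂ) (hw : ContDiffAt ℝ 1 w z)
    (hu : ContDiffAt ℝ 1 u z) :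
    dz (fun z => w z - c * u z) =ᶠ[𝓝 z] fun z => dz w z - c * dz u z := by
  filter_upwards [hw.eventually (by simp), hu.eventually (by simp)] with y hy hy'
  exact dz_sub_const_mul c (hy.differentiableAt (by norm_num)) (hy'.differentiableAt (by norm_num))

theorem eventually_dzbar_sub_const_mul {u w : ℂ → ℂ} {z : ℂ} (c : ℂ) (hw : ContDiffAt ℝ 1 w z)
    (hu : ContDiffAt ℝ 1 u z) :
    dzbar (fun z => w z - c * u z) =ᶠ[𝓝 z] fun z => dzbar w z - c * dzbar u z := by
  filter_upwards [hw.eventually (by simp), hu.eventually (by simp)] with y hy hy'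
  exact dzbar_sub_const_mul c (hy.differentiableAt (by norm_num))
    (hy'.differentiableAt (by norm_num))

theorem dz_dz_dzbar_dzbar_sub_const_mul {u w : ℂ → ℂ} {z : ℂ} (c : ℂ) (hw : ContDiffAt ℝ 4 w z)
    (hu : ContDiffAt ℝ 4 u z) :
    dz (dz (dzbar (dzbar fun z => w z - c * u z))) z =
      dz (dz (dzbar (dzbar w))) z - c * dz (dz (dzbar (dzbar u))) z := by
  have hw3 : ContDiffAt ℝ 3 (dzbar w) z := hw.dzbar (by norm_num)
  have hu3 : ContDiffAt ℝ 3 (dzbar u) z := hu.dzbar (by norm_num)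
  have hw2 : ContDiffAt ℝ 2 (dzbar (dzbar w)) z := hw3.dzbar (by norm_num)
  have hu2 : ContDiffAt ℝ 2 (dzbar (dzbar u)) z := hu3.dzbar (by norm_num)
  have hw1 : ContDiffAt ℝ 1 (dz (dzbar (dzbar w))) z := hw2.dz (by norm_num)
  have hu1 : ContDiffAt ℝ 1 (dz (dzbar (dzbar u))) z := hu2.dz (by norm_num)
  have h1 := eventually_dzbar_sub_const_mul c (hw.of_le (by norm_num)) (hu.of_le (by norm_num))
  have h2 := h1.dzbar.trans
    (eventually_dzbar_sub_const_mul c (hw3.of_le (by norm_num)) (hu3.of_le (by norm_num)))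
  have h3 := h2.dz.trans
    (eventually_dz_sub_const_mul c (hw2.of_le (by norm_num)) (hu2.of_le (by norm_num)))
  exact h3.dz_eq.trans (dz_sub_const_mul c (hw1.differentiableAt (by norm_num))
    (hu1.differentiableAt (by norm_num)))

/-- The comparison principle: if `|Δ²u| ≤ Re Δ²w`, then the same holds for the defects. -/
theorem norm_dirichlet_defect_le {u w : ℂ → ℂ} (hR : 1 < R)
    (hu : ∀ z ∈ ball (0 : ℂ) R, ContDiffAt ℝ 4 u z)
    (hw : ∀ z ∈ ball (0 : ℂ) R, ContDiffAt ℝ 4 w z)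
    (hle : ∀ z ∈ closedBall (0 : ℂ) 1,
      ‖dz (dz (dzbar (dzbar u))) z‖ ≤ (dz (dz (dzbar (dzbar w))) z).re) :
    ‖u 0 - circleAverage u 0 1 + circleAverage (fun z => conj z * dzbar u z) 0 1‖ ≤
      (w 0 - circleAverage w 0 1 + circleAverage (fun z => conj z * dzbar w z) 0 1).re := by
  have hsub : sphere (0 : ℂ) 1 ⊆ ball 0 R := sphere_subset_ball_of_lt hR
  have ci : ∀ {F : ℂ → ℂ}, (∀ z ∈ ball (0 : ℂ) R, ContDiffAt ℝ 4 F z) →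
      CircleIntegrable F 0 1 := fun hF => ContinuousOn.circleIntegrable zero_le_one fun z hz =>
    (hF z (hsub hz)).continuousAt.continuousWithinAt
  have ci' : ∀ {F : ℂ → ℂ}, (∀ z ∈ ball (0 : ℂ) R, ContDiffAt ℝ 4 F z) →
      CircleIntegrable (fun z => conj z * dzbar F z) 0 1 := fun hF =>
    ContinuousOn.circleIntegrable zero_le_one <| Complex.continuous_conj.continuousOn.mul
      (continuousOn_dzbar fun z hz => (hF z (hsub hz)).of_le (by norm_num))
  set X := u 0 - circleAverage u 0 1 + circleAverage (fun z => conj z * dzbar u z) 0 1 with hX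
  set Y := w 0 - circleAverage w 0 1 + circleAverage (fun z => conj z * dzbar w z) 0 1 with hY
  -- `c` rotates `X` onto the nonnegative axis. Only `‖c‖ ≤ 1` is needed, so the value `c = 0` that
  -- division by zero gives for `X = 0` is harmless.
  obtain ⟨c, hc, hcX⟩ : ∃ c : ℂ, ‖c‖ ≤ 1 ∧ c * X = ‖X‖ := by
    refine ⟨conj X / ‖X‖, ?_, ?_⟩
    · rw [norm_div, RCLike.norm_conj, Complex.norm_real, norm_norm]
      exact div_self_le_one _
    · rw [div_mul_eq_mul_div, mul_comm, Complex.mul_conj, Complex.normSq_eq_norm_sq]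
      by_cases h : X = 0
      · simp [h]
      · have : (‖X‖ : ℂ) ≠ 0 := by simpa using h
        push_cast
        field_simp
  have hv : ∀ z ∈ ball (0 : ℂ) R, ContDiffAt ℝ 4 (fun z => w z - c * u z) z := fun z hz =>
    (hw z hz).sub (contDiffAt_const.mul (hu z hz))
  have key := re_dirichlet_defect_nonneg hR hv fun z hz => by
    have hz' : z ∈ ball (0 : ℂ) R := closedBall_subset_ball hR hz
    rw [dz_dz_dzbar_dzbar_sub_const_mul c (hw z hz') (hu z hz'), Complex.sub_re]
    have h1 := Complex.re_le_norm (c * dz (dz (dzbar (dzbar u))) z)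
    rw [norm_mul] at h1
    have h2 := mul_le_of_le_one_left (norm_nonneg (dz (dz (dzbar (dzbar u))) z)) hc
    linarith [hle z hz]
  have e1 : circleAverage (fun z => w z - c * u z) 0 1 =
      circleAverage w 0 1 - c * circleAverage u 0 1 := by
    rw [circleAverage_fun_sub (ci hw) ((ci hu).mul_left c), circleAverage_const_mul]
  have e2 : circleAverage (fun z => conj z * dzbar (fun z => w z - c * u z) z) 0 1 =
      circleAverage (fun z => conj z * dzbar w z) 0 1 -
        c * circleAverage (fun z => conj z * dzbar u z) 0 1 := by
    rw [← circleAverage_const_mul, ← circleAverage_fun_sub (ci' hw) ((ci' hu).mul_left c)]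
    refine circleAverage_congr_sphere fun z hz => ?_
    rw [abs_one] at hz
    rw [dzbar_sub_const_mul c ((hw z (hsub hz)).differentiableAt (by norm_num))
      ((hu z (hsub hz)).differentiableAt (by norm_num))]
    ring
  rw [e1, e2] at key
  have e3 : w 0 - c * u 0 - (circleAverage w 0 1 - c * circleAverage u 0 1) +
      (circleAverage (fun z => conj z * dzbar w z) 0 1 -
        c * circleAverage (fun z => conj z * dzbar u z) 0 1) = Y - ‖X‖ := by
    rw [← hcX, hX, hY]; ring
  rw [e3, Complex.sub_re, Complex.ofReal_re] at key
  linarith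

end RadialDerivative

/-! ### Disk automorphisms and conformal covariance of the bilaplacian -/

/-- The denominator `1 + ā w` of the Möbius map `mobius a`. -/
def mobiusDen (a w : ℂ) : ℂ := 1 + conj a * w

/-- The disk automorphism `w ↦ (w + a) / (1 + ā w)`. -/
def mobius (a w : ℂ) : ℂ := (w + a) / mobiusDen a w

/-- The weighted pullback `|1 + ā w|² f (φ w)` under the disk automorphism `φ = mobius a`,
which intertwines `Δ²` with a multiple of itself. -/
def mobiusPullback (a : ℂ) (f : ℂ → ℂ) (w : ℂ) : ℂ :=
  mobiusDen a w * (conj (mobiusDen a w) * f (mobius a w))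

section

variable {a w : ℂ} {f : ℂ → ℂ}

theorem mobiusDen_ne_zero (ha : ‖a‖ < 1) (hw : ‖w‖ ≤ 1) : mobiusDen a w ≠ 0 := by
  intro h
  have h1 : conj a * w = -1 := by rw [mobiusDen] at h; linear_combination h
  have h2 : ‖a‖ * ‖w‖ = 1 := by simpa using congrArg norm h1
  nlinarith [norm_nonneg a, norm_nonneg w]

theorem hasDerivAt_mobiusDen (a w : ℂ) : HasDerivAt (mobiusDen a) (conj a) w :=
  (((hasDerivAt_id w).const_mul (conj a)).const_add 1).congr_deriv (mul_one _)

theorem hasDerivAt_mobius (hw : mobiusDen a w ≠ 0) :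
    HasDerivAt (mobius a) ((1 - a * conj a) / mobiusDen a w ^ 2) w := by
  refine (((hasDerivAt_id w).add_const a).div (hasDerivAt_mobiusDen a w) hw).congr_deriv ?_
  congr 1
  simp only [mobiusDen, id]
  ring

theorem contDiffAt_mobiusDen (n : WithTop ℕ∞) : ContDiffAt ℝ n (mobiusDen a) w :=
  contDiffAt_const.add (contDiffAt_const.mul contDiffAt_id)

theorem contDiffAt_mobius (hw : mobiusDen a w ≠ 0) (n : WithTop ℕ∞) :
    ContDiffAt ℝ n (mobius a) w :=
  ((contDiffAt_id.add contDiffAt_const).mul ((contDiffAt_mobiusDen n).inv hw)).congr_of_eventuallyEq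
    (Eventually.of_forall fun _ => div_eq_mul_inv _ _)

theorem contDiffAt_mobiusPullback (hw : mobiusDen a w ≠ 0) {n : WithTop ℕ∞}
    (hf : ContDiffAt ℝ n f (mobius a w)) : ContDiffAt ℝ n (mobiusPullback a f) w :=
  (contDiffAt_mobiusDen n).mul (((Complex.conjCLE.contDiff.contDiffAt).comp w
    (contDiffAt_mobiusDen n)).mul (hf.comp w (contDiffAt_mobius hw n)))

theorem eventually_mobius (hw : mobiusDen a w ≠ 0) {n : WithTop ℕ∞} (hn : n ≠ ((⊤ : ℕ∞) : WithTop ℕ∞))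
    (hf : ContDiffAt ℝ n f (mobius a w)) :
    ∀ᶠ y in 𝓝 w, mobiusDen a y ≠ 0 ∧ ContDiffAt ℝ n f (mobius a y) :=
  ((hasDerivAt_mobiusDen a w).continuousAt.eventually_ne hw).and
    ((hasDerivAt_mobius hw).continuousAt.eventually (hf.eventually hn))

theorem hasWirtingerAt_comp_mobius (hw : mobiusDen a w ≠ 0)
    (hf : DifferentiableAt ℝ f (mobius a w)) :
    HasWirtingerAt (fun y => f (mobius a y))
      (dz f (mobius a w) * ((1 - a * conj a) / mobiusDen a w ^ 2))
      (dzbar f (mobius a w) * ((1 - a * conj a) / conj (mobiusDen a w) ^ 2)) w :=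
  (hf.hasWirtingerAt.comp_hasDerivAt (hasDerivAt_mobius hw)).congr_deriv rfl (by
    simp [mul_comm])

theorem hasWirtingerAt_mobiusDen (a w : ℂ) : HasWirtingerAt (mobiusDen a) (conj a) 0 w :=
  .of_hasDerivAt (hasDerivAt_mobiusDen a w)

theorem hasWirtingerAt_conj_mobiusDen (a w : ℂ) :
    HasWirtingerAt (fun y => conj (mobiusDen a y)) 0 a w :=
  (hasWirtingerAt_mobiusDen a w).star.congr_deriv (by simp) (by simp)

theorem hasWirtingerAt_inv_mobiusDen (hw : mobiusDen a w ≠ 0) :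
    HasWirtingerAt (fun y => (mobiusDen a y)⁻¹) (-conj a / mobiusDen a w ^ 2) 0 w :=
  .of_hasDerivAt ((hasDerivAt_mobiusDen a w).inv hw)

theorem hasWirtingerAt_conj_inv_mobiusDen (hw : mobiusDen a w ≠ 0) :
    HasWirtingerAt (fun y => (conj (mobiusDen a y))⁻¹) 0 (-a / conj (mobiusDen a w) ^ 2) w :=
  ((hasWirtingerAt_inv_mobiusDen hw).star.congr_deriv (by simp) (by simp)).congr_of_eventuallyEq
    (Eventually.of_forall fun y => by simp)

theorem dzbar_mobiusPullback (hw : mobiusDen a w ≠ 0) (hf : DifferentiableAt ℝ f (mobius a w)) :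
    dzbar (mobiusPullback a f) w = mobiusDen a w * (a * f (mobius a w) +
      (1 - a * conj a) * (dzbar f (mobius a w) * (conj (mobiusDen a w))⁻¹)) := by
  have h := (hasWirtingerAt_mobiusDen a w).mul
    ((hasWirtingerAt_conj_mobiusDen a w).mul (hasWirtingerAt_comp_mobius hw hf))
  refine (HasWirtingerAt.dzbar_eq h).trans ?_
  have : conj (mobiusDen a w) ≠ 0 := by simpa using hw
  field_simp
  ring

/-- For `∂̄` the factor `mobiusDen` is a constant, and the conjugate factor is exactly the weight
for which the two terms in `∂̄f` cancel, leaving only the second derivative. -/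
theorem dzbar_dzbar_mobiusPullback (hw : mobiusDen a w ≠ 0)
    (hf : ContDiffAt ℝ 2 f (mobius a w)) :
    dzbar (dzbar (mobiusPullback a f)) w = (1 - a * conj a) ^ 2 * ((conj (mobiusDen a w))⁻¹ ^ 3 *
      (mobiusDen a w * dzbar (dzbar f) (mobius a w))) := by
  have h1 : dzbar (mobiusPullback a f) =ᶠ[𝓝 w] fun w => mobiusDen a w * (a * f (mobius a w) +
      (1 - a * conj a) * (dzbar f (mobius a w) * (conj (mobiusDen a w))⁻¹)) := by
    filter_upwards [eventually_mobius hw (by simp) hf] with y hy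
    exact dzbar_mobiusPullback hy.1 (hy.2.differentiableAt (by norm_num))
  rw [h1.dzbar_eq]
  have hf' : DifferentiableAt ℝ (dzbar f) (mobius a w) :=
    (hf.dzbar (m := 1) (by norm_num)).differentiableAt (by norm_num)
  have h2 := (hasWirtingerAt_mobiusDen a w).mul
    (((hasWirtingerAt_comp_mobius hw (hf.differentiableAt (by norm_num))).const_mul a).add
      (((hasWirtingerAt_comp_mobius hw hf').mul
        (hasWirtingerAt_conj_inv_mobiusDen hw)).const_mul (1 - a * conj a)))
  refine (HasWirtingerAt.dzbar_eq h2).trans ?_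
  have : conj (mobiusDen a w) ≠ 0 := by simpa using hw
  field_simp
  ring

/-- The conjugate cancellation: the antiholomorphic cube is constant for `∂`, and the remaining
weight `mobiusDen` removes the first-order terms. -/
theorem dz_dz_conj_inv_mul_comp_mobius (hw : mobiusDen a w ≠ 0)
    (hf : ContDiffAt ℝ 2 f (mobius a w)) (c : ℂ) :
    dz (dz fun w => c * ((conj (mobiusDen a w))⁻¹ ^ 3 * (mobiusDen a w * f (mobius a w)))) w =
      c * (1 - a * conj a) ^ 2 * ((conj (mobiusDen a w))⁻¹ ^ 3 * ((mobiusDen a w)⁻¹ ^ 3 *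
        dz (dz f) (mobius a w))) := by
  have hcube : ∀ {y : ℂ}, mobiusDen a y ≠ 0 →
      ∃ q, HasWirtingerAt (fun y => (conj (mobiusDen a y))⁻¹ ^ 3) 0 q y := fun hy => by
    have h := hasWirtingerAt_conj_inv_mobiusDen hy
    refine ⟨_, ((h.mul (h.mul h)).congr_deriv (by simp) rfl).congr_of_eventuallyEq
      (Eventually.of_forall fun y => by ring)⟩
  have h1 : (dz fun w => c * ((conj (mobiusDen a w))⁻¹ ^ 3 *
      (mobiusDen a w * f (mobius a w)))) =ᶠ[𝓝 w] fun w => c * ((conj (mobiusDen a w))⁻¹ ^ 3 *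
      (conj a * f (mobius a w) +
        (1 - a * conj a) * (dz f (mobius a w) * (mobiusDen a w)⁻¹))) := by
    filter_upwards [eventually_mobius hw (by simp) hf] with y hy
    obtain ⟨q, hq⟩ := hcube hy.1
    have h := (hq.mul ((hasWirtingerAt_mobiusDen a y).mul
      (hasWirtingerAt_comp_mobius hy.1 (hy.2.differentiableAt (by norm_num))))).const_mul c
    refine (HasWirtingerAt.dz_eq h).trans ?_
    have := hy.1
    field_simp
    ring
  rw [h1.dz_eq]
  have hf' : DifferentiableAt ℝ (dz f) (mobius a w) :=
    (hf.dz (m := 1) (by norm_num)).differentiableAt (by norm_num)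
  obtain ⟨q, hq⟩ := hcube hw
  have h2 := (hq.mul
    (((hasWirtingerAt_comp_mobius hw (hf.differentiableAt (by norm_num))).const_mul (conj a)).add
      (((hasWirtingerAt_comp_mobius hw hf').mul
        (hasWirtingerAt_inv_mobiusDen hw)).const_mul (1 - a * conj a)))).const_mul c
  refine (HasWirtingerAt.dz_eq h2).trans ?_
  field_simp
  ring

/-- Conformal covariance of the bilaplacian. -/
theorem bilaplacian_mobiusPullback (hw : mobiusDen a w ≠ 0)
    (hf : ContDiffAt ℝ 4 f (mobius a w)) :
    dz (dz (dzbar (dzbar (mobiusPullback a f)))) w =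
      (((1 - ‖a‖ ^ 2) ^ 4 / ‖mobiusDen a w‖ ^ 6 : ℝ) : ℂ) *
        dz (dz (dzbar (dzbar f))) (mobius a w) := by
  have hf2 : ContDiffAt ℝ 2 (dzbar (dzbar f)) (mobius a w) :=
    (hf.dzbar (m := 3) (by norm_num)).dzbar (by norm_num)
  have h1 : dzbar (dzbar (mobiusPullback a f)) =ᶠ[𝓝 w] fun w => (1 - a * conj a) ^ 2 *
      ((conj (mobiusDen a w))⁻¹ ^ 3 * (mobiusDen a w * dzbar (dzbar f) (mobius a w))) := by
    filter_upwards [eventually_mobius hw (by simp) hf] with y hy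
    exact dzbar_dzbar_mobiusPullback hy.1 (hy.2.of_le (by norm_num))
  rw [h1.dz.dz_eq, dz_dz_conj_inv_mul_comp_mobius hw hf2]
  have h2 : ((‖mobiusDen a w‖ ^ 6 : ℝ) : ℂ) = (mobiusDen a w * conj (mobiusDen a w)) ^ 3 := by
    rw [Complex.mul_conj, Complex.normSq_eq_norm_sq]; push_cast; ring
  have h3 : ((1 - ‖a‖ ^ 2 : ℝ) : ℂ) = 1 - a * conj a := by
    rw [Complex.mul_conj, Complex.normSq_eq_norm_sq]; push_cast; ring
  have : conj (mobiusDen a w) ≠ 0 := by simpa using hw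
  rw [Complex.ofReal_div, h2, Complex.ofReal_pow, h3]
  field_simp

/-- This identity is why the automorphism preserves both the closed disk and the circle. -/
theorem normSq_mobiusDen_sub (a w : ℂ) :
    ‖mobiusDen a w‖ ^ 2 - ‖w + a‖ ^ 2 = (1 - ‖a‖ ^ 2) * (1 - ‖w‖ ^ 2) := by
  simp only [← Complex.normSq_eq_norm_sq, Complex.normSq_apply, mobiusDen]
  simp
  ring

theorem norm_mobius_le_one (ha : ‖a‖ < 1) (hw : ‖w‖ ≤ 1) : ‖mobius a w‖ ≤ 1 := by
  have h := normSq_mobiusDen_sub a w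
  have h0 := norm_pos_iff.mpr (mobiusDen_ne_zero ha hw)
  rw [mobius, norm_div, div_le_one h0]
  refine le_of_sq_le_sq ?_ h0.le
  have : 0 ≤ (1 - ‖a‖ ^ 2) * (1 - ‖w‖ ^ 2) :=
    mul_nonneg (by nlinarith [norm_nonneg a]) (by nlinarith [norm_nonneg w])
  linarith

theorem norm_mobius_eq_one (ha : ‖a‖ < 1) (hw : ‖w‖ = 1) : ‖mobius a w‖ = 1 := by
  have h := normSq_mobiusDen_sub a w
  have h0 := norm_pos_iff.mpr (mobiusDen_ne_zero ha hw.le)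
  rw [mobius, norm_div, div_eq_one_iff_eq h0.ne']
  rw [hw] at h
  exact (sq_eq_sq₀ (norm_nonneg _) h0.le).mp (by linarith)

end

/-- Smoothness of finite order is an open condition and the closed disk is compact. The extra room
lets the radial argument run up to radius `1`. -/
theorem exists_ball_contDiffAt {u : ℂ → ℂ}
    (hu : ∀ z ∈ closedBall (0 : ℂ) 1, ContDiffAt ℝ 4 u z) :
    ∃ R, 1 < R ∧ ∀ z ∈ ball (0 : ℂ) R, ContDiffAt ℝ 4 u z := by
  have ho : IsOpen {z | ContDiffAt ℝ 4 u z} := isOpen_iff_mem_nhds.mpr fun z hz =>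
    ContDiffAt.eventually hz (by simp)
  obtain ⟨δ, hδ, h⟩ := (isCompact_closedBall (0 : ℂ) 1).exists_thickening_subset_open ho hu
  rw [thickening_closedBall hδ zero_le_one] at h
  exact ⟨δ + 1, by linarith, fun z hz => h hz⟩

/-- The defect of the weighted pullback is expressed through the boundary values of `f`. -/
theorem dirichlet_defect_mobiusPullback {a : ℂ} {f : ℂ → ℂ} (ha : ‖a‖ < 1)
    (hf : ∀ z ∈ closedBall (0 : ℂ) 1, ContDiffAt ℝ 4 f z) :
    mobiusPullback a f 0 - circleAverage (mobiusPullback a f) 0 1 +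
        circleAverage (fun z => conj z * dzbar (mobiusPullback a f) z) 0 1 =
      f a - circleAverage (fun ζ => (fun η => (1 - a * conj a) / (1 - conj a * η) * f η -
        (1 - a * conj a) * phiOne (dzbar f) η) (mobius a ζ)) 0 1 := by
  have hmem : ∀ {w : ℂ}, ‖w‖ ≤ 1 → mobius a w ∈ closedBall (0 : ℂ) 1 := fun hw => by
    simpa using norm_mobius_le_one ha hw
  have hP : ∀ w ∈ sphere (0 : ℂ) 1, ContDiffAt ℝ 4 (mobiusPullback a f) w := fun w hw => by
    have hw : ‖w‖ ≤ 1 := by simp_all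
    exact contDiffAt_mobiusPullback (mobiusDen_ne_zero ha hw) (hf _ (hmem hw))
  have i1 : CircleIntegrable (mobiusPullback a f) 0 1 := ContinuousOn.circleIntegrable zero_le_one
    fun w hw => (hP w hw).continuousAt.continuousWithinAt
  have i2 : CircleIntegrable (fun z => conj z * dzbar (mobiusPullback a f) z) 0 1 :=
    ContinuousOn.circleIntegrable zero_le_one <| Complex.continuous_conj.continuousOn.mul
      (continuousOn_dzbar fun z hz => (hP z hz).of_le (by norm_num))
  have h0 : mobiusPullback a f 0 = f a := by simp [mobiusPullback, mobius, mobiusDen]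
  rw [h0, sub_add, ← circleAverage_fun_sub i1 i2]
  congr 1
  refine circleAverage_congr_sphere fun ζ hζ => ?_
  have hn : ‖ζ‖ = 1 := by simpa using hζ
  have hD := mobiusDen_ne_zero ha hn.le
  have hD' : conj (mobiusDen a ζ) ≠ 0 := by simpa using hD
  have hζζ : ζ * conj ζ = 1 := by rw [Complex.mul_conj, Complex.normSq_eq_norm_sq, hn]; simp
  have hc : 1 - a * conj a ≠ 0 := by
    rw [Complex.mul_conj, Complex.normSq_eq_norm_sq]
    have : 1 - ‖a‖ ^ 2 ≠ 0 := by nlinarith [norm_nonneg a]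
    exact_mod_cast this
  -- This and `e2` express the weight and `conj ζ` through the image point `mobius a ζ`.
  have e1 : (1 - a * conj a) / (1 - conj a * mobius a ζ) = mobiusDen a ζ := by
    have : 1 - conj a * mobius a ζ = (1 - a * conj a) / mobiusDen a ζ := by
      rw [mobius]
      field_simp
      simp only [mobiusDen]
      ring
    rw [this]
    field_simp
  have e2 : conj (mobius a ζ) = conj ζ * mobiusDen a ζ * (conj (mobiusDen a ζ))⁻¹ := by
    have : conj ζ * mobiusDen a ζ = conj (ζ + a) := by
      simp only [mobiusDen, map_add]
      linear_combination (conj a) * hζζ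
    rw [this, mobius, map_div₀, div_eq_mul_inv]
  -- The zeroth-order part of `∂̄` of the pullback lowers the weight from `|1 + ā ζ|²` to `1 + ā ζ`.
  have e3 : conj (mobiusDen a ζ) - conj ζ * a = 1 := by
    simp [mobiusDen]; ring
  simp only [e1, phiOne, e2]
  rw [dzbar_mobiusPullback hD ((hf _ (hmem hn.le)).differentiableAt (by norm_num)),
    mobiusPullback]
  linear_combination (mobiusDen a ζ * f (mobius a ζ)) * e3

/-! ### Poisson integrals through disk automorphisms -/

section Poisson

theorem ContinuousOn.continuous_comp_circleMap {E : Type*} [NormedAddCommGroup E]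
    {G : ℂ → E} (hG : ContinuousOn G (sphere 0 1)) :
    Continuous fun t => G (circleMap 0 1 t) :=
  hG.comp_continuous (continuous_circleMap 0 1) fun t => circleMap_mem_sphere 0 zero_le_one t

variable {E : Type*} [NormedAddCommGroup E] [NormedSpace ℝ E]

theorem norm_sub_of_norm_eq_one {a ζ : ℂ} (hζ : ‖ζ‖ = 1) : ‖ζ - a‖ = ‖1 - conj a * ζ‖ := by
  have h : ζ * conj ζ = 1 := by rw [Complex.mul_conj, Complex.normSq_eq_norm_sq, hζ]; simp
  have : 1 - conj a * ζ = ζ * conj (ζ - a) := by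
    rw [map_sub]; linear_combination -h
  rw [this, norm_mul, hζ, one_mul, RCLike.norm_conj]

theorem poissonKernel_of_norm_eq_one {a ζ : ℂ} (hζ : ‖ζ‖ = 1) :
    poissonKernel 0 a ζ = (1 - ‖a‖ ^ 2) / ‖1 - conj a * ζ‖ ^ 2 := by
  rw [poissonKernel_def, sub_zero, sub_zero, hζ, norm_sub_of_norm_eq_one hζ, one_pow]

theorem one_sub_conj_mul_ne_zero {a ζ : ℂ} (ha : ‖a‖ < 1) (hζ : ‖ζ‖ = 1) :
    1 - conj a * ζ ≠ 0 := by
  rw [← norm_ne_zero_iff, ← norm_sub_of_norm_eq_one hζ, norm_ne_zero_iff, sub_ne_zero]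
  rintro rfl
  linarith

theorem poissonKernel_nonneg {a ζ : ℂ} (ha : ‖a‖ < 1) (hζ : ‖ζ‖ = 1) :
    0 ≤ poissonKernel 0 a ζ := by
  rw [poissonKernel_of_norm_eq_one hζ]
  have := norm_nonneg a
  exact div_nonneg (by nlinarith) (by positivity)

theorem continuousOn_poissonKernel {a : ℂ} (ha : ‖a‖ < 1) :
    ContinuousOn (poissonKernel 0 a) (sphere 0 1) := by
  have : ContinuousOn (fun ζ : ℂ => (1 - ‖a‖ ^ 2) / ‖1 - conj a * ζ‖ ^ 2) (sphere 0 1) := by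
    refine ContinuousOn.div (by fun_prop) (by fun_prop) fun ζ hζ => ?_
    have := one_sub_conj_mul_ne_zero ha (mem_sphere_zero_iff_norm.mp hζ)
    positivity
  exact this.congr fun ζ hζ => poissonKernel_of_norm_eq_one (mem_sphere_zero_iff_norm.mp hζ)

theorem circleAverage_poissonKernel {a : ℂ} (ha : ‖a‖ < 1) :
    circleAverage (poissonKernel 0 a) 0 1 = 1 := by
  have h := (diffContOnCl_const (c := (1 : ℂ)) (s := ball 0 1)).circleAverage_poissonKernel_smul
    (w := a) (by simpa using ha)
  have h2 := Complex.ofRealCLM.circleAverage_comp_comm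
    ((continuousOn_poissonKernel ha).circleIntegrable zero_le_one)
  have h3 : (poissonKernel 0 a • fun _ => (1 : ℂ)) = Complex.ofRealCLM ∘ poissonKernel 0 a := by
    ext ζ; simp
  rw [h3, h2, Complex.ofRealCLM_apply] at h
  exact_mod_cast h

theorem norm_circleAverage_le_circleAverage_norm (F : ℂ → E) :
    ‖circleAverage F 0 1‖ ≤ circleAverage (fun ζ => ‖F ζ‖) 0 1 := by
  rw [circleAverage_def, circleAverage_def, norm_smul, smul_eq_mul,
    Real.norm_of_nonneg (by positivity)]
  exact mul_le_mul_of_nonneg_left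
    (intervalIntegral.norm_integral_le_integral_norm two_pi_pos.le) (by positivity)

/-- Change of variables on the unit circle under a disk automorphism. -/
theorem circleAverage_poissonKernel_smul_comp_mobius {a : ℂ} (ha : ‖a‖ < 1) {G : ℂ → E}
    (hG : ContinuousOn G (sphere 0 1)) :
    circleAverage (fun ζ => poissonKernel 0 (-a) ζ • G (mobius a ζ)) 0 1 =
      circleAverage G 0 1 := by
  have ha' : ‖-a‖ < 1 := by rwa [norm_neg]
  set ρ : ℝ → ℝ := fun t => poissonKernel 0 (-a) (circleMap 0 1 t) with hρ
  have cρ : Continuous ρ := (continuousOn_poissonKernel ha').continuous_comp_circleMap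
  have hcm : ∀ t, ‖circleMap 0 1 t‖ = 1 := fun t => by simp
  have hD : ∀ t, mobiusDen a (circleMap 0 1 t) ≠ 0 := fun t => mobiusDen_ne_zero ha (hcm t).le
  -- A continuous angle of the image point: along the circle the automorphism turns at the speed of
  -- the Poisson kernel at `-a`. Dividing the image by `e^{iθ}` gives zero derivative, which proves
  -- the formula without choosing branches of the argument.
  set θ : ℝ → ℝ := fun t => Complex.arg (mobius a (circleMap 0 1 0)) + ∫ s in 0..t, ρ s with hθ
  have dθ : ∀ t, HasDerivAt θ (ρ t) t := fun t =>
    (intervalIntegral.integral_hasDerivAt_right (cρ.intervalIntegrable _ _)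
      (cρ.stronglyMeasurableAtFilter _ _) cρ.continuousAt).const_add _
  have dh : ∀ t, HasDerivAt (fun t : ℝ => mobius a (circleMap 0 1 t) *
      Complex.exp (-(θ t * Complex.I))) 0 t := by
    intro t
    have h1 := (hasDerivAt_mobius (hD t)).comp_of_eq t (hasDerivAt_circleMap 0 1 t) rfl
    have h2 := (((dθ t).ofReal_comp.mul_const Complex.I).neg).cexp
    refine (h1.mul h2).congr_deriv ?_
    have hc : conj (mobiusDen a (circleMap 0 1 t)) ≠ 0 := by simpa using hD t
    have e1 : (ρ t : ℂ) = (1 - a * conj a) /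
        (mobiusDen a (circleMap 0 1 t) * conj (mobiusDen a (circleMap 0 1 t))) := by
      rw [hρ]
      simp only
      rw [poissonKernel_of_norm_eq_one (hcm t), Complex.mul_conj, Complex.mul_conj,
        Complex.normSq_eq_norm_sq, Complex.normSq_eq_norm_sq, norm_neg, mobiusDen]
      simp
    have e2 : circleMap 0 1 t + a = circleMap 0 1 t * conj (mobiusDen a (circleMap 0 1 t)) := by
      have : circleMap 0 1 t * conj (circleMap 0 1 t) = 1 := by
        rw [Complex.mul_conj, Complex.normSq_eq_norm_sq, hcm]; simp
      simp only [mobiusDen, map_add, map_one, map_mul, Complex.conj_conj]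
      linear_combination -a * this
    have := hD t
    rw [e1, Function.comp, mobius, e2]
    field_simp
    ring
  have hconst : ∀ t, mobius a (circleMap 0 1 t) = circleMap 0 1 (θ t) := by
    intro t
    have h1 := is_const_of_deriv_eq_zero (fun t => (dh t).differentiableAt)
      (fun t => (dh t).deriv) t 0
    have h2 : ‖mobius a (circleMap 0 1 0)‖ = 1 := norm_mobius_eq_one ha (hcm 0)
    have h3 : mobius a (circleMap 0 1 0) = Complex.exp (θ 0 * Complex.I) := by
      have := Complex.norm_mul_exp_arg_mul_I (mobius a (circleMap 0 1 0))
      rw [h2] at this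
      rw [hθ]
      simpa using this.symm
    have h4 : mobius a (circleMap 0 1 0) * Complex.exp (-(θ 0 * Complex.I)) = 1 := by
      rw [h3, ← Complex.exp_add, add_neg_cancel, Complex.exp_zero]
    simp only [h4] at h1
    rw [Complex.exp_neg, ← div_eq_mul_inv, div_eq_one_iff_eq (Complex.exp_ne_zero _)] at h1
    rw [h1]
    simp [circleMap]
  -- The kernel has mean `1`, so the image winds round exactly once.
  have h2π : θ (2 * π) = θ 0 + 2 * π := by
    have h := circleAverage_poissonKernel ha'
    rw [circleAverage_def, smul_eq_mul, inv_mul_eq_iff_eq_mul₀ two_pi_pos.ne', mul_one] at h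
    simp only [hθ, intervalIntegral.integral_same, add_zero]
    exact congrArg _ h
  rw [circleAverage_def, circleAverage_def]
  congr 1
  have cG := hG.continuous_comp_circleMap
  have h := intervalIntegral.integral_deriv_smul_comp (a := 0) (b := 2 * π)
    (g := fun t => G (circleMap 0 1 t)) (fun t _ => dθ t) cρ.continuousOn cG
  have h' : ∫ t in 0..2 * π, poissonKernel 0 (-a) (circleMap 0 1 t) •
      G (mobius a (circleMap 0 1 t)) =
      ∫ t in 0..2 * π, ρ t • ((fun t => G (circleMap 0 1 t)) ∘ θ) t := by
    refine intervalIntegral.integral_congr fun t _ => ?_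
    simp only [hconst t, Function.comp, hρ]
  rw [h', h, h2π]
  have hper : Function.Periodic (fun t => G (circleMap 0 1 t)) (2 * π) := fun t => by
    simp [periodic_circleMap 0 1 t]
  simpa using hper.intervalIntegral_add_eq (θ 0) 0

theorem continuousOn_mobius {a : ℂ} (ha : ‖a‖ < 1) : ContinuousOn (mobius a) (sphere 0 1) :=
  fun _ hζ => (hasDerivAt_mobius (mobiusDen_ne_zero ha
    (mem_sphere_zero_iff_norm.mp hζ).le)).continuousAt.continuousWithinAt

/-- The Poisson integral is the mean of the boundary function moved by a disk automorphism. -/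
theorem circleAverage_comp_mobius {a : ℂ} (ha : ‖a‖ < 1) {F : ℂ → E}
    (hF : ContinuousOn F (sphere 0 1)) :
    circleAverage (fun ζ => F (mobius a ζ)) 0 1 = poissonIntegral F a := by
  refine Eq.trans ?_ (circleAverage_poissonKernel_smul_comp_mobius ha
    ((continuousOn_poissonKernel ha).smul hF))
  refine circleAverage_congr_sphere fun ζ hζ => ?_
  have hn : ‖ζ‖ = 1 := by simpa using hζ
  have hD := mobiusDen_ne_zero ha hn.le
  have hc : 1 - ‖a‖ ^ 2 ≠ 0 := by nlinarith [norm_nonneg a]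
  have h1 : mobius a ζ - a = (1 - ‖a‖ ^ 2 : ℝ) * ζ / mobiusDen a ζ := by
    have : ((1 - ‖a‖ ^ 2 : ℝ) : ℂ) = 1 - a * conj a := by
      rw [Complex.mul_conj, Complex.normSq_eq_norm_sq]; push_cast; ring
    rw [this, mobius]
    field_simp
    simp only [mobiusDen]
    ring
  -- The kernels at `-a` and `a` are the Jacobians of mutually inverse automorphisms, hence
  -- reciprocal.
  have h2 : poissonKernel 0 (-a) ζ * poissonKernel 0 a (mobius a ζ) = 1 := by
    rw [poissonKernel_of_norm_eq_one hn, poissonKernel_def, sub_zero, sub_zero,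
      norm_mobius_eq_one ha hn, h1, norm_div, norm_mul, hn, Complex.norm_real, Real.norm_eq_abs,
      mul_one, div_pow, sq_abs, norm_neg]
    have : 1 - conj (-a) * ζ = mobiusDen a ζ := by simp [mobiusDen]
    rw [this]
    have : ‖mobiusDen a ζ‖ ≠ 0 := norm_ne_zero_iff.mpr hD
    field_simp
  simp only [smul_smul, h2, one_smul]

theorem norm_poissonIntegral_le {a : ℂ} (ha : ‖a‖ < 1) {F : ℂ → E} {M : ℝ}
    (hF : ContinuousOn F (sphere 0 1)) (hM : ∀ ζ ∈ sphere (0 : ℂ) 1, ‖F ζ‖ ≤ M) :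
    ‖poissonIntegral F a‖ ≤ M := by
  rw [← circleAverage_comp_mobius ha hF]
  have hmaps : MapsTo (mobius a) (sphere 0 1) (sphere 0 1) := fun _ hζ => by
    simpa using norm_mobius_eq_one ha (mem_sphere_zero_iff_norm.mp hζ)
  refine (norm_circleAverage_le_circleAverage_norm _).trans
    (circleAverage_mono_on_of_le_circle ?_ fun ζ hζ => ?_)
  · exact (hF.comp (continuousOn_mobius ha) hmaps).norm.circleIntegrable zero_le_one
  · rw [abs_one] at hζ
    exact hM _ (hmaps hζ)

theorem norm_poissonIntegral_le_discSup {a : ℂ} (ha : ‖a‖ < 1) {F : ℂ → E}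
    (hF : ContinuousOn F (sphere 0 1)) :
    ‖poissonIntegral F a‖ ≤ discSup (poissonIntegral F) := by
  obtain ⟨M, hM⟩ := (isCompact_sphere (0 : ℂ) 1).exists_bound_of_continuousOn hF
  refine le_ciSup (f := fun z : ball (0 : ℂ) 1 => ‖poissonIntegral F z‖) ⟨M, ?_⟩
    ⟨a, by simpa using ha⟩
  rintro _ ⟨z, rfl⟩
  exact norm_poissonIntegral_le (mem_ball_zero_iff.mp z.2) hF hM

/-- The Poisson integral has the radial limit `F η` at `η`. -/
theorem tendsto_poissonIntegral_radial [CompleteSpace E] {F : ℂ → E} (hF : ContinuousOn F (sphere 0 1)) {η : ℂ}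
    (hη : ‖η‖ = 1) :
    Tendsto (fun s : ℝ => poissonIntegral F (s * η)) (𝓝[<] 1) (𝓝 (F η)) := by
  obtain ⟨M, hM⟩ := (isCompact_sphere (0 : ℂ) 1).exists_bound_of_continuousOn hF
  have hs : ∀ᶠ s : ℝ in 𝓝[<] 1, ‖(s : ℂ) * η‖ < 1 := by
    filter_upwards [Ioo_mem_nhdsLT (show (0 : ℝ) < 1 by norm_num)] with s hs
    rw [norm_mul, hη, mul_one, Complex.norm_real, Real.norm_of_nonneg hs.1.le]
    exact hs.2
  have hmaps : ∀ {a : ℂ}, ‖a‖ < 1 → MapsTo (mobius a) (sphere 0 1) (sphere 0 1) :=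
    fun ha ζ hζ => by simpa using norm_mobius_eq_one ha (mem_sphere_zero_iff_norm.mp hζ)
  -- As `s → 1`, `mobius (s η)` sends every point of the circle except `-η` towards `η`, so
  -- dominated convergence applies to the means of `F ∘ mobius (s η)`.
  have key : Tendsto (fun s : ℝ => circleAverage (fun ζ => F (mobius (s * η) ζ)) 0 1) (𝓝[<] 1)
      (𝓝 (circleAverage (fun _ => F η) 0 1)) := by
    simp only [circleAverage_def]
    refine Tendsto.const_smul ?_ _
    refine intervalIntegral.tendsto_integral_filter_of_dominated_convergence (fun _ => M) ?_ ?_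
      intervalIntegrable_const ?_
    · filter_upwards [hs] with s hs
      exact (hF.comp (continuousOn_mobius hs)
        (hmaps hs)).continuous_comp_circleMap.aestronglyMeasurable
    · filter_upwards [hs] with s hs
      exact Eventually.of_forall fun t _ => hM _ (hmaps hs (circleMap_mem_sphere 0 zero_le_one t))
    · have hcount : {t | circleMap 0 1 t = -η}.Countable :=
        (countable_singleton (-η)).preimage_circleMap 0 one_ne_zero
      filter_upwards [hcount.ae_notMem MeasureTheory.volume] with t ht _
      set ζ := circleMap 0 1 t with hζ
      have hηη : η * conj η = 1 := by rw [Complex.mul_conj, Complex.normSq_eq_norm_sq, hη]; simp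
      have hne : 1 + conj η * ζ ≠ 0 := by
        intro h
        apply ht
        linear_combination η * h - ζ * hηη
      have hmob : Tendsto (fun s : ℝ => mobius (s * η) ζ) (𝓝[<] 1) (𝓝 η) := by
        have hval : (ζ + ((1 : ℝ) : ℂ) * η) / (1 + conj (((1 : ℝ) : ℂ) * η) * ζ) = η := by
          have : 1 + conj (((1 : ℝ) : ℂ) * η) * ζ ≠ 0 := by simpa using hne
          rw [div_eq_iff this]
          simp only [Complex.ofReal_one, one_mul]
          linear_combination -ζ * hηη
        have hc : ContinuousAt (fun s : ℝ =>
            (ζ + (s : ℂ) * η) / (1 + conj ((s : ℂ) * η) * ζ)) 1 := by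
          refine ContinuousAt.div (by fun_prop) (by fun_prop) ?_
          simpa using hne
        have := hc.tendsto
        rw [hval] at this
        exact this.mono_left nhdsWithin_le_nhds
      have hη' : η ∈ sphere (0 : ℂ) 1 := by simpa using hη
      refine (hF η hη').tendsto.comp (tendsto_nhdsWithin_iff.mpr ⟨hmob, ?_⟩)
      filter_upwards [hs] with s hs
      exact hmaps hs (circleMap_mem_sphere 0 zero_le_one t)
  rw [circleAverage_const] at key
  refine key.congr' ?_
  filter_upwards [hs] with s hs
  exact circleAverage_comp_mobius hs hF

/-- Boundary values are radial limits of the Poisson integral. Bounds by the boundary data thereby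
become bounds by the supremum over the open disk. -/
theorem norm_le_discSup_poissonIntegral [CompleteSpace E] {F : ℂ → E}
    (hF : ContinuousOn F (sphere 0 1)) {η : ℂ} (hη : ‖η‖ = 1) :
    ‖F η‖ ≤ discSup (poissonIntegral F) := by
  refine le_of_tendsto (tendsto_poissonIntegral_radial hF hη).norm ?_
  filter_upwards [Ioo_mem_nhdsLT (show (0 : ℝ) < 1 by norm_num)] with s hs
  refine norm_poissonIntegral_le_discSup ?_ hF
  rw [norm_mul, hη, mul_one, Complex.norm_real, Real.norm_of_nonneg hs.1.le]
  exact hs.2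

end Poisson

/-! ### The harmonic Schwarz lemma -/

section HarmonicSchwarz

theorem one_sub_mul_cos_pos {r : ℝ} (hr : 0 ≤ r) (hr1 : r < 1) (t : ℝ) : 0 < 1 - r * cos t := by
  nlinarith [cos_le_one t]

theorem poisson_denom_pos {r : ℝ} (hr : 0 ≤ r) (hr1 : r < 1) (t : ℝ) :
    0 < 1 - 2 * r * cos t + r ^ 2 := by
  nlinarith [cos_le_one t, sq_nonneg (1 - r), mul_nonneg hr (sub_nonneg.mpr (cos_le_one t))]

/-- The kernel is `1 + 2 ∑ rⁿ cos nt`, with primitive `t - 2 arg(1 - r e^{it})`. As `1 - r cos t >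
0`, the `arctan` form is smooth for all `t`. -/
theorem hasDerivAt_poisson_antideriv {r : ℝ} (hr : 0 ≤ r) (hr1 : r < 1) (t : ℝ) :
    HasDerivAt (fun t => t + 2 * arctan (r * sin t / (1 - r * cos t)))
      ((1 - r ^ 2) / (1 - 2 * r * cos t + r ^ 2)) t := by
  have h0 := (one_sub_mul_cos_pos hr hr1 t).ne'
  have h1 := (poisson_denom_pos hr hr1 t).ne'
  have hd := ((((hasDerivAt_sin t).const_mul r).div
    (((hasDerivAt_cos t).const_mul r).const_sub 1) h0).arctan.const_mul 2)
  refine ((hasDerivAt_id t).add hd).congr_deriv ?_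
  have hsc : sin t ^ 2 = 1 - cos t ^ 2 := by linarith [sin_sq_add_cos_sq t]
  have h2 : 1 + (r * sin t / (1 - r * cos t)) ^ 2 =
      (1 - 2 * r * cos t + r ^ 2) / (1 - r * cos t) ^ 2 := by
    field_simp
    linear_combination r ^ 2 * hsc
  simp only [Pi.div_apply]
  rw [h2]
  field_simp
  linear_combination (-2 * r ^ 2) * hsc

/-- The constant is the kernel's value where `cos t = 0`, so the difference is nonnegative on the
first half of this period and nonpositive on the second. Both halves have length `π`: the linear
parts of the primitive cancel, and each half leaves `4 arctan r`. -/
theorem integral_abs_poisson_sub {r : ℝ} (hr : 0 ≤ r) (hr1 : r < 1) :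
    ∫ t in (-(π / 2))..(3 * π / 2),
      |(1 - r ^ 2) / (1 - 2 * r * cos t + r ^ 2) - (1 - r ^ 2) / (1 + r ^ 2)| = 8 * arctan r := by
  set k := (1 - r ^ 2) / (1 + r ^ 2) with hk
  have hcont : Continuous fun t => (1 - r ^ 2) / (1 - 2 * r * cos t + r ^ 2) :=
    Continuous.div (by fun_prop) (by fun_prop) fun t => (poisson_denom_pos hr hr1 t).ne'
  have hnum : 0 ≤ 1 - r ^ 2 := by nlinarith
  have ftc : ∀ a b, ∫ t in a..b, ((1 - r ^ 2) / (1 - 2 * r * cos t + r ^ 2) - k) =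
      (b + 2 * arctan (r * sin b / (1 - r * cos b)) - k * b) -
        (a + 2 * arctan (r * sin a / (1 - r * cos a)) - k * a) := fun a b => by
    refine intervalIntegral.integral_eq_sub_of_hasDerivAt
      (f := fun t => t + 2 * arctan (r * sin t / (1 - r * cos t)) - k * t) (fun t _ => ?_)
      ((hcont.sub continuous_const).intervalIntegrable _ _)
    exact ((hasDerivAt_poisson_antideriv hr hr1 t).sub
      ((hasDerivAt_id t).const_mul k)).congr_deriv (by rw [mul_one])
  have hint : ∀ a b, IntervalIntegrable (fun t => |(1 - r ^ 2) / (1 - 2 * r * cos t + r ^ 2) - k|)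
      MeasureTheory.volume a b := fun a b =>
    (hcont.sub continuous_const).abs.intervalIntegrable _ _
  rw [← intervalIntegral.integral_add_adjacent_intervals (hint _ (π / 2)) (hint _ _)]
  have h1 : ∫ t in (-(π / 2))..(π / 2), |(1 - r ^ 2) / (1 - 2 * r * cos t + r ^ 2) - k| =
      ∫ t in (-(π / 2))..(π / 2), ((1 - r ^ 2) / (1 - 2 * r * cos t + r ^ 2) - k) := by
    refine intervalIntegral.integral_congr fun t ht => abs_of_nonneg (sub_nonneg.mpr ?_)
    rw [uIcc_of_le (by linarith [pi_pos])] at ht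
    have := mul_nonneg hr (cos_nonneg_of_mem_Icc ht)
    exact div_le_div_of_nonneg_left hnum (poisson_denom_pos hr hr1 t) (by linarith)
  have h2 : ∫ t in (π / 2)..(3 * π / 2), |(1 - r ^ 2) / (1 - 2 * r * cos t + r ^ 2) - k| =
      -∫ t in (π / 2)..(3 * π / 2), ((1 - r ^ 2) / (1 - 2 * r * cos t + r ^ 2) - k) := by
    rw [← intervalIntegral.integral_neg]
    refine intervalIntegral.integral_congr fun t ht => abs_of_nonpos (sub_nonpos.mpr ?_)
    rw [uIcc_of_le (by linarith [pi_pos])] at ht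
    have := mul_nonneg hr (neg_nonneg.mpr (cos_nonpos_of_pi_div_two_le_of_le ht.1
      (by linarith [ht.2])))
    exact div_le_div_of_nonneg_left hnum (by positivity) (by linarith)
  have s3 : sin (3 * π / 2) = -1 := by
    rw [show 3 * π / 2 = π / 2 + π by ring, sin_add_pi, sin_pi_div_two]
  have c3 : cos (3 * π / 2) = 0 := by
    rw [show 3 * π / 2 = π / 2 + π by ring, cos_add_pi, cos_pi_div_two, neg_zero]
  rw [h1, h2, ftc, ftc, s3, c3, sin_neg, cos_neg, sin_pi_div_two, cos_pi_div_two]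
  simp [arctan_neg]
  ring

theorem circleAverage_abs_poissonKernel_sub {a : ℂ} (ha : ‖a‖ < 1) :
    circleAverage (fun ζ => |poissonKernel 0 a ζ - (1 - ‖a‖ ^ 2) / (1 + ‖a‖ ^ 2)|) 0 1 =
      4 / π * arctan ‖a‖ := by
  -- Shifting the angle by `arg a` reduces to a point on the nonnegative real axis.
  rw [circleAverage_eq_integral_add (Complex.arg a)]
  have hk : ∀ t, poissonKernel 0 a (circleMap 0 1 (t + Complex.arg a)) =
      (1 - ‖a‖ ^ 2) / (1 - 2 * ‖a‖ * cos t + ‖a‖ ^ 2) := by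
    intro t
    have h1 : circleMap 0 1 (t + Complex.arg a) - a =
        Complex.exp (Complex.arg a * Complex.I) * (Complex.exp (t * Complex.I) - ‖a‖) := by
      simp only [circleMap, zero_add, Complex.ofReal_one, one_mul, Complex.ofReal_add, add_mul,
        Complex.exp_add]
      linear_combination Complex.norm_mul_exp_arg_mul_I a
    have h2 : ‖circleMap 0 1 (t + Complex.arg a) - a‖ ^ 2 =
        1 - 2 * ‖a‖ * cos t + ‖a‖ ^ 2 := by
      rw [h1, norm_mul, Complex.norm_exp_ofReal_mul_I, one_mul, ← Complex.normSq_eq_norm_sq,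
        Complex.normSq_apply]
      simp only [Complex.sub_re, Complex.sub_im, Complex.exp_ofReal_mul_I_re,
        Complex.exp_ofReal_mul_I_im, Complex.ofReal_re, Complex.ofReal_im]
      linear_combination sin_sq_add_cos_sq t
    rw [poissonKernel_def, sub_zero, sub_zero, h2]
    simp
  simp only [hk]
  have hper : Function.Periodic (fun t => |(1 - ‖a‖ ^ 2) / (1 - 2 * ‖a‖ * cos t + ‖a‖ ^ 2) -
      (1 - ‖a‖ ^ 2) / (1 + ‖a‖ ^ 2)|) (2 * π) := fun t => by simp
  have h := hper.intervalIntegral_add_eq 0 (-(π / 2))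
  rw [zero_add, show -(π / 2) + 2 * π = 3 * π / 2 by ring,
    integral_abs_poisson_sub (norm_nonneg a) ha] at h
  rw [h, smul_eq_mul]
  field_simp
  ring

theorem poissonIntegral_zero {E : Type*} [NormedAddCommGroup E] [NormedSpace ℝ E] (F : ℂ → E) :
    poissonIntegral F 0 = circleAverage F 0 1 := by
  refine circleAverage_congr_sphere fun ζ hζ => ?_
  have hn : ‖ζ‖ = 1 := by simpa using hζ
  simp [poissonKernel_of_norm_eq_one hn]

/-- The harmonic Schwarz lemma. -/
theorem norm_poissonIntegral_sub_le {F : ℂ → ℂ} (hF : ContinuousOn F (sphere 0 1)) {a : ℂ}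
    (ha : ‖a‖ < 1) :
    ‖poissonIntegral F a - (((1 - ‖a‖ ^ 2) / (1 + ‖a‖ ^ 2) : ℝ) : ℂ) * poissonIntegral F 0‖ ≤
      4 / π * discSup (poissonIntegral F) * arctan ‖a‖ := by
  set k : ℝ := (1 - ‖a‖ ^ 2) / (1 + ‖a‖ ^ 2) with hk
  have cP := continuousOn_poissonKernel ha
  have i1 : CircleIntegrable (fun ζ => poissonKernel 0 a ζ • F ζ) 0 1 :=
    (cP.smul hF).circleIntegrable zero_le_one
  have i2 := (hF.circleIntegrable zero_le_one).mul_left k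
  have c3 : ContinuousOn (fun ζ => |poissonKernel 0 a ζ - k|) (sphere 0 1) :=
    (cP.sub continuousOn_const).abs
  rw [poissonIntegral_zero, poissonIntegral, ← circleAverage_const_mul,
    ← circleAverage_fun_sub i1 i2]
  -- The difference is the mean of `(kernel - k) F`; bound `F` pointwise and use the exact L¹ norm
  -- of `kernel - k`.
  have h1 : 4 / π * discSup (poissonIntegral F) * arctan ‖a‖ =
      circleAverage (fun ζ => discSup (poissonIntegral F) * |poissonKernel 0 a ζ - k|) 0 1 := by
    have := circleAverage_fun_smul (a := discSup (poissonIntegral F))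
      (f := fun ζ => |poissonKernel 0 a ζ - k|) (c := 0) (R := 1)
    simp only [smul_eq_mul] at this
    rw [this, circleAverage_abs_poissonKernel_sub ha]
    ring
  rw [h1]
  refine (norm_circleAverage_le_circleAverage_norm _).trans (circleAverage_mono ?_ ?_ ?_)
  · exact ((cP.smul hF).sub (continuousOn_const.mul hF)).norm.circleIntegrable zero_le_one
  · exact (continuousOn_const.mul c3).circleIntegrable zero_le_one
  · intro ζ hζ
    have hn : ‖ζ‖ = 1 := by simpa using hζ
    rw [Complex.real_smul, ← sub_mul, norm_mul, mul_comm, ← Complex.ofReal_sub, Complex.norm_real,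
      Real.norm_eq_abs]
    exact mul_le_mul_of_nonneg_right (norm_le_discSup_poissonIntegral hF hn) (abs_nonneg _)

end HarmonicSchwarz

/-! ### The extremal function -/

section Model

variable (c : ℂ)

theorem hasWirtingerAt_one_sub_mul_conj (z : ℂ) :
    HasWirtingerAt (fun z => 1 - z * conj z) (-conj z) (-z) z :=
  ((HasWirtingerAt.const 1 z).sub ((HasWirtingerAt.id z).mul (.conj_id z))).congr_deriv
    (by simp) (by simp)

theorem dzbar_model :
    dzbar (fun z => c * ((1 - z * conj z) * (1 - z * conj z))) =
      fun z => -2 * c * (z * (1 - z * conj z)) := by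
  ext z
  have h := hasWirtingerAt_one_sub_mul_conj z
  rw [((h.mul h).const_mul c).dzbar_eq]
  ring

theorem dzbar_dzbar_model :
    dzbar (dzbar fun z => c * ((1 - z * conj z) * (1 - z * conj z))) =
      fun z => 2 * c * (z * z) := by
  ext z
  rw [dzbar_model, (((HasWirtingerAt.id z).mul
    (hasWirtingerAt_one_sub_mul_conj z)).const_mul (-2 * c)).dzbar_eq]
  ring

/-- With the factor `16`, the bilaplacian is `64 c`: this is the origin of the constant `1/64`. -/
theorem dz_dz_dzbar_dzbar_model :
    dz (dz (dzbar (dzbar fun z => c * ((1 - z * conj z) * (1 - z * conj z))))) =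
      fun _ => 4 * c := by
  have : dz (dzbar (dzbar fun z => c * ((1 - z * conj z) * (1 - z * conj z)))) =
      fun z => 4 * c * z := by
    ext z
    rw [dzbar_dzbar_model, (((HasWirtingerAt.id z).mul (.id z)).const_mul (2 * c)).dz_eq]
    ring
  ext z
  rw [this, ((HasWirtingerAt.id z).const_mul (4 * c)).dz_eq, mul_one]

theorem contDiff_model {n : WithTop ℕ∞} :
    ContDiff ℝ n fun z : ℂ => c * ((1 - z * conj z) * (1 - z * conj z)) := by
  have h : ContDiff ℝ n fun z : ℂ => 1 - z * conj z :=
    contDiff_const.sub (contDiff_id.mul Complex.conjCLE.contDiff)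
  exact contDiff_const.mul (h.mul h)

theorem model_eq (M : ℝ) :
    (fun z : ℂ => ((M / 64 * (1 - ‖z‖ ^ 2) ^ 2 : ℝ) : ℂ)) =
      fun z => ((M / 64 : ℝ) : ℂ) * ((1 - z * conj z) * (1 - z * conj z)) := by
  ext z
  rw [Complex.mul_conj, Complex.normSq_eq_norm_sq]
  push_cast
  ring

end Model

/-! ### The Green potential estimate for functions smooth up to the boundary -/

theorem mul_conj_eq_one_of_norm {ζ : ℂ} (hζ : ‖ζ‖ = 1) : ζ * conj ζ = 1 := by
  rw [Complex.mul_conj, Complex.normSq_eq_norm_sq, hζ]; simp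

theorem one_sub_mul_conj (a : ℂ) : 1 - a * conj a = ((1 - ‖a‖ ^ 2 : ℝ) : ℂ) := by
  rw [Complex.mul_conj, Complex.normSq_eq_norm_sq]; push_cast; ring

/-- The combination of the boundary data whose Poisson integral at `a` is the value at `a` of the
biharmonic function with these data. -/
def dirichletDatum (a : ℂ) (F φ : ℂ → ℂ) (η : ℂ) : ℂ :=
  (1 - a * conj a) / (1 - conj a * η) * F η - (1 - a * conj a) * phiOne φ η

theorem continuousOn_dirichletDatum {a : ℂ} (ha : ‖a‖ < 1) {F φ : ℂ → ℂ}
    (hF : ContinuousOn F (sphere 0 1)) (hφ : ContinuousOn φ (sphere 0 1)) :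
    ContinuousOn (dirichletDatum a F φ) (sphere 0 1) := by
  refine ContinuousOn.sub (ContinuousOn.mul ?_ hF)
    (continuousOn_const.mul (hφ.mul Complex.continuous_conj.continuousOn))
  exact ContinuousOn.div (by fun_prop) (by fun_prop) fun η hη =>
    one_sub_conj_mul_ne_zero ha (mem_sphere_zero_iff_norm.mp hη)

theorem dirichlet_defect_mobiusPullback_eq {a : ℂ} {f : ℂ → ℂ} (ha : ‖a‖ < 1)
    (hf : ∀ z ∈ closedBall (0 : ℂ) 1, ContDiffAt ℝ 4 f z) :
    mobiusPullback a f 0 - circleAverage (mobiusPullback a f) 0 1 +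
        circleAverage (fun z => conj z * dzbar (mobiusPullback a f) z) 0 1 =
      f a - poissonIntegral (dirichletDatum a f (dzbar f)) a := by
  rw [dirichlet_defect_mobiusPullback ha hf, ← circleAverage_comp_mobius ha]
  · rfl
  · have hf' : ∀ z ∈ sphere (0 : ℂ) 1, ContDiffAt ℝ 4 f z := fun z hz =>
      hf z (sphere_subset_closedBall hz)
    exact continuousOn_dirichletDatum ha
      (fun z hz => (hf' z hz).continuousAt.continuousWithinAt)
      (continuousOn_dzbar fun z hz => (hf' z hz).of_le (by norm_num))

/-- The Green potential estimate for functions that are smooth up to the boundary. -/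
theorem norm_sub_poissonIntegral_dirichletDatum_le_of_contDiffAt {a : ℂ} {f : ℂ → ℂ} {K : ℝ}
    (ha : ‖a‖ < 1) (hf : ∀ z ∈ closedBall (0 : ℂ) 1, ContDiffAt ℝ 4 f z)
    (hK : ∀ z ∈ closedBall (0 : ℂ) 1, ‖dz (dz (dzbar (dzbar f))) z‖ ≤ K / 16) :
    ‖f a - poissonIntegral (dirichletDatum a f (dzbar f)) a‖ ≤
      K / 64 * (1 - ‖a‖ ^ 2) ^ 2 := by
  set c : ℂ := ((K / 64 : ℝ) : ℂ) with hc
  set w : ℂ → ℂ := fun z => c * ((1 - z * conj z) * (1 - z * conj z)) with hw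
  have hw4 : ∀ z ∈ closedBall (0 : ℂ) 1, ContDiffAt ℝ 4 w z := fun z _ =>
    (contDiff_model c).contDiffAt
  have hmem : ∀ {z : ℂ}, z ∈ closedBall (0 : ℂ) 1 → mobius a z ∈ closedBall (0 : ℂ) 1 :=
    fun hz => mem_closedBall_zero_iff.mpr (norm_mobius_le_one ha (mem_closedBall_zero_iff.mp hz))
  have hden : ∀ {z : ℂ}, z ∈ closedBall (0 : ℂ) 1 → mobiusDen a z ≠ 0 :=
    fun hz => mobiusDen_ne_zero ha (mem_closedBall_zero_iff.mp hz)
  obtain ⟨R₁, hR₁, hu⟩ := exists_ball_contDiffAt (u := mobiusPullback a f) fun z hz =>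
    contDiffAt_mobiusPullback (hden hz) (hf _ (hmem hz))
  obtain ⟨R₂, hR₂, hv⟩ := exists_ball_contDiffAt (u := mobiusPullback a w) fun z hz =>
    contDiffAt_mobiusPullback (hden hz) (hw4 _ (hmem hz))
  -- Both pullbacks acquire the same nonnegative covariance factor, so the hypothesis on `f`
  -- transfers to the comparison at the centre.
  have key := norm_dirichlet_defect_le (lt_min hR₁ hR₂)
    (fun z hz => hu z (ball_subset_ball (min_le_left _ _) hz))
    (fun z hz => hv z (ball_subset_ball (min_le_right _ _) hz)) fun z hz => by
      have hpos : 0 ≤ (1 - ‖a‖ ^ 2) ^ 4 / ‖mobiusDen a z‖ ^ 6 := by positivity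
      rw [bilaplacian_mobiusPullback (hden hz) (hf _ (hmem hz)),
        bilaplacian_mobiusPullback (hden hz) (hw4 _ (hmem hz)), hw, dz_dz_dzbar_dzbar_model,
        Complex.re_ofReal_mul, norm_mul, Complex.norm_real, Real.norm_of_nonneg hpos]
      refine mul_le_mul_of_nonneg_left ((hK _ (hmem hz)).trans_eq ?_) hpos
      have : 4 * c = ((K / 16 : ℝ) : ℂ) := by rw [hc]; push_cast; ring
      rw [this, Complex.ofReal_re]
  rw [dirichlet_defect_mobiusPullback_eq ha hf, dirichlet_defect_mobiusPullback_eq ha hw4] at key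
  -- The model and its `∂̄` both vanish on the circle, so its defect is just its value at `a`.
  have h0 : poissonIntegral (dirichletDatum a w (dzbar w)) a = 0 := by
    have : circleAverage (fun ζ => poissonKernel 0 a ζ • dirichletDatum a w (dzbar w) ζ) 0 1 =
        circleAverage (fun _ => (0 : ℂ)) 0 1 := circleAverage_congr_sphere fun ζ hζ => by
      have hn : ‖ζ‖ = 1 := by simpa using hζ
      simp [hw, dirichletDatum, phiOne, dzbar_model, mul_conj_eq_one_of_norm hn]
    rw [poissonIntegral, this, circleAverage_const]
  have hwa : w a = ((K / 64 * (1 - ‖a‖ ^ 2) ^ 2 : ℝ) : ℂ) := by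
    rw [hw, hc]
    simp only [one_sub_mul_conj]
    push_cast
    ring
  rwa [h0, sub_zero, hwa, Complex.ofReal_re] at key

/-! ### Dilations and the general Green potential estimate -/

section Dilation

variable {F : ℂ → ℂ} {s z : ℂ}

theorem ContDiffAt.comp_mul_left {n : WithTop ℕ∞} (hF : ContDiffAt ℝ n F (s * z)) :
    ContDiffAt ℝ n (fun y => F (s * y)) z :=
  hF.comp z (contDiffAt_const.mul contDiffAt_id)

theorem hasWirtingerAt_dilation (c : ℂ) (hF : DifferentiableAt ℝ F (s * z)) :
    HasWirtingerAt (fun y => c * F (s * y)) (c * s * dz F (s * z))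
      (c * conj s * dzbar F (s * z)) z :=
  ((hF.hasWirtingerAt.comp_hasDerivAt (φ := fun y => s * y)
    (((hasDerivAt_id z).const_mul s).congr_deriv (mul_one s))).const_mul c).congr_deriv
    (by ring) (by ring)

theorem eventually_dz_dilation (c : ℂ) (hF : ContDiffAt ℝ 1 F (s * z)) :
    dz (fun y => c * F (s * y)) =ᶠ[𝓝 z] fun y => c * s * dz F (s * y) := by
  have hc : ContinuousAt (fun y => s * y) z := by fun_prop
  filter_upwards [hc.eventually (hF.eventually (by simp))] with y hy
  exact (hasWirtingerAt_dilation c (hy.differentiableAt (by norm_num))).dz_eq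

theorem eventually_dzbar_dilation (c : ℂ) (hF : ContDiffAt ℝ 1 F (s * z)) :
    dzbar (fun y => c * F (s * y)) =ᶠ[𝓝 z] fun y => c * conj s * dzbar F (s * y) := by
  have hc : ContinuousAt (fun y => s * y) z := by fun_prop
  filter_upwards [hc.eventually (hF.eventually (by simp))] with y hy
  exact (hasWirtingerAt_dilation c (hy.differentiableAt (by norm_num))).dzbar_eq

theorem dz_dz_dzbar_dzbar_dilation (hF : ContDiffAt ℝ 4 F (s * z)) :
    dz (dz (dzbar (dzbar fun y => F (s * y)))) z =
      conj s * conj s * s * s * dz (dz (dzbar (dzbar F))) (s * z) := by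
  have h3 : ContDiffAt ℝ 3 (dzbar F) (s * z) := hF.dzbar (by norm_num)
  have h2 : ContDiffAt ℝ 2 (dzbar (dzbar F)) (s * z) := h3.dzbar (by norm_num)
  have h1 : ContDiffAt ℝ 1 (dz (dzbar (dzbar F))) (s * z) := h2.dz (by norm_num)
  have e1 := eventually_dzbar_dilation 1 (hF.of_le (by norm_num))
  have e2 := e1.dzbar.trans (eventually_dzbar_dilation _ (h3.of_le (by norm_num)))
  have e3 := e2.dz.trans (eventually_dz_dilation _ (h2.of_le (by norm_num)))
  have e4 := (e3.dz.trans (eventually_dz_dilation _ h1)).eq_of_nhds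
  simpa only [one_mul] using e4

/-- Dominated convergence: `F` is bounded on the compact disk, and only `F` is dilated, so `k` need
be defined well only on the circle. -/
theorem tendsto_circleAverage_dilation {k F : ℂ → ℂ} (hk : ContinuousOn k (sphere 0 1))
    (hF : ContinuousOn F (closedBall 0 1)) :
    Tendsto (fun s : ℝ => circleAverage (fun η => k η * F (s * η)) 0 1) (𝓝[<] 1)
      (𝓝 (circleAverage (fun η => k η * F η) 0 1)) := by
  obtain ⟨M, hM⟩ := (isCompact_closedBall (0 : ℂ) 1).exists_bound_of_continuousOn hF
  obtain ⟨N, hN⟩ := (isCompact_sphere (0 : ℂ) 1).exists_bound_of_continuousOn hk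
  have hN0 : 0 ≤ N := (norm_nonneg _).trans (hN 1 (by simp))
  have hs : ∀ᶠ s : ℝ in 𝓝[<] 1, ∀ η ∈ sphere (0 : ℂ) 1, (s : ℂ) * η ∈ closedBall (0 : ℂ) 1 := by
    filter_upwards [Ioo_mem_nhdsLT (show (0 : ℝ) < 1 by norm_num)] with s hs η hη
    rw [mem_closedBall_zero_iff, norm_mul, mem_sphere_zero_iff_norm.mp hη, mul_one,
      Complex.norm_real, Real.norm_of_nonneg hs.1.le]
    exact hs.2.le
  have hmem := fun t => circleMap_mem_sphere (0 : ℂ) zero_le_one t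
  simp only [circleAverage_def]
  refine Tendsto.const_smul ?_ _
  refine intervalIntegral.tendsto_integral_filter_of_dominated_convergence (fun _ => N * M) ?_ ?_
    intervalIntegrable_const ?_
  · filter_upwards [hs] with s hs
    exact (ContinuousOn.continuous_comp_circleMap (G := fun η => k η * F (s * η)) (hk.mul
      (hF.comp (by fun_prop) hs))).aestronglyMeasurable
  · filter_upwards [hs] with s hs
    refine Eventually.of_forall fun t _ => ?_
    rw [norm_mul]
    exact mul_le_mul (hN _ (hmem t)) (hM _ (hs _ (hmem t))) (norm_nonneg _) hN0
  · refine Eventually.of_forall fun t _ => Tendsto.const_mul _ ?_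
    refine (hF _ (sphere_subset_closedBall (hmem t))).tendsto.comp
      (tendsto_nhdsWithin_iff.mpr ⟨?_, hs.mono fun s hs => hs _ (hmem t)⟩)
    have : ContinuousAt (fun s : ℝ => (s : ℂ) * circleMap 0 1 t) 1 := by fun_prop
    simpa using this.tendsto.mono_left nhdsWithin_le_nhds

end Dilation

theorem circleIntegrable_poissonKernel_smul {E : Type*} [NormedAddCommGroup E] [NormedSpace ℝ E]
    {a : ℂ} (ha : ‖a‖ < 1) {F : ℂ → E} (hF : ContinuousOn F (sphere 0 1)) :
    CircleIntegrable (fun ζ => poissonKernel 0 a ζ • F ζ) 0 1 :=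
  ((continuousOn_poissonKernel ha).smul hF).circleIntegrable zero_le_one

theorem norm_le_discSup {g : ℂ → ℂ} (hg : ContinuousOn g (closedBall 0 1)) {z : ℂ}
    (hz : z ∈ ball (0 : ℂ) 1) : ‖g z‖ ≤ discSup g := by
  obtain ⟨M, hM⟩ := (isCompact_closedBall (0 : ℂ) 1).exists_bound_of_continuousOn hg
  refine le_ciSup (f := fun z : ball (0 : ℂ) 1 => ‖g z‖) ⟨M, ?_⟩ ⟨z, hz⟩
  rintro _ ⟨y, rfl⟩
  exact hM _ (ball_subset_closedBall y.2)

theorem discSup_nonneg {E : Type*} [NormedAddCommGroup E] (u : ℂ → E) : 0 ≤ discSup u :=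
  Real.iSup_nonneg fun _ => norm_nonneg _

namespace SolvesBiharmonicDirichlet

variable {g φ fstar f : ℂ → ℂ}

theorem contDiffAt (h : SolvesBiharmonicDirichlet g φ fstar f) {z : ℂ}
    (hz : z ∈ ball (0 : ℂ) 1) : ContDiffAt ℝ 4 f z :=
  h.f_contDiff.contDiffAt (isOpen_ball.mem_nhds hz)

theorem fstar_cont (h : SolvesBiharmonicDirichlet g φ fstar f) :
    ContinuousOn fstar (sphere 0 1) :=
  (h.f_cont.mono sphere_subset_closedBall).congr fun ζ hζ => (h.boundary_value ζ hζ).symm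

theorem phiOne_cont (h : SolvesBiharmonicDirichlet g φ fstar f) :
    ContinuousOn (phiOne φ) (sphere 0 1) :=
  h.φ_cont.mul Complex.continuous_conj.continuousOn

-- On the circle `fderiv` may take its default value, so `dzbar f` is replaced there by `φ`.
-- Continuity at the boundary combines the interior limits with the continuity of `φ` along the
-- circle.
open scoped Classical in
theorem continuousOn_dzbar_extension (h : SolvesBiharmonicDirichlet g φ fstar f) :
    ContinuousOn ((ball (0 : ℂ) 1).piecewise (dzbar f) φ) (closedBall 0 1) := by
  intro z hz
  have hunion : closedBall (0 : ℂ) 1 = ball 0 1 ∪ sphere 0 1 := ball_union_sphere.symm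
  by_cases hzb : z ∈ ball (0 : ℂ) 1
  · have h1 : ContinuousAt (dzbar f) z :=
      ((h.contDiffAt hzb).dzbar (m := 0) (by norm_num)).continuousAt
    refine (h1.congr ?_).continuousWithinAt
    filter_upwards [isOpen_ball.mem_nhds hzb] with y hy
    exact (piecewise_eq_of_mem _ _ _ hy).symm
  · have hzs : z ∈ sphere (0 : ℂ) 1 := (hunion ▸ hz).resolve_left hzb
    rw [ContinuousWithinAt, hunion, nhdsWithin_union, tendsto_sup, piecewise_eq_of_notMem _ _ _ hzb]
    refine ⟨(h.boundary_dzbar z hzs).congr' ?_, (h.φ_cont z hzs).tendsto.congr' ?_⟩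
    · filter_upwards [self_mem_nhdsWithin] with y hy
      exact (piecewise_eq_of_mem _ _ _ hy).symm
    · filter_upwards [self_mem_nhdsWithin] with y hy
      refine (piecewise_eq_of_notMem _ _ _ fun hy' => ?_).symm
      rw [mem_ball_zero_iff, mem_sphere_zero_iff_norm.mp hy] at hy'
      exact lt_irrefl _ hy'

open scoped Classical in
/-- The Green potential estimate. -/
theorem norm_sub_poissonIntegral_dirichletDatum_le (h : SolvesBiharmonicDirichlet g φ fstar f)
    {a : ℂ} (ha : ‖a‖ < 1) :
    ‖f a - poissonIntegral (dirichletDatum a fstar φ) a‖ ≤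
      discSup g / 64 * (1 - ‖a‖ ^ 2) ^ 2 := by
  set d := (ball (0 : ℂ) 1).piecewise (dzbar f) φ with hd
  have cd : ContinuousOn d (closedBall 0 1) := h.continuousOn_dzbar_extension
  set c := 1 - a * conj a with hc
  set k₁ : ℂ → ℂ := fun η => poissonKernel 0 a η * (c / (1 - conj a * η)) with hk₁
  set k₂ : ℂ → ℂ := fun η => poissonKernel 0 a η * (c * conj η) with hk₂
  have cP : ContinuousOn (fun η => (poissonKernel 0 a η : ℂ)) (sphere 0 1) :=
    Complex.continuous_ofReal.comp_continuousOn (continuousOn_poissonKernel ha)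
  have ck₁ : ContinuousOn k₁ (sphere 0 1) :=
    cP.mul (ContinuousOn.div (by fun_prop) (by fun_prop) fun η hη =>
      one_sub_conj_mul_ne_zero ha (mem_sphere_zero_iff_norm.mp hη))
  have ck₂ : ContinuousOn k₂ (sphere 0 1) :=
    cP.mul (continuousOn_const.mul Complex.continuous_conj.continuousOn)
  have hsplit : ∀ {F G : ℂ → ℂ}, ContinuousOn F (sphere 0 1) → ContinuousOn G (sphere 0 1) →
      poissonIntegral (dirichletDatum a F G) a =
        circleAverage (fun η => k₁ η * F η) 0 1 - circleAverage (fun η => k₂ η * G η) 0 1 := by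
    intro F G hF hG
    refine Eq.trans ?_ (circleAverage_fun_sub (f₁ := fun η => k₁ η * F η)
      (f₂ := fun η => k₂ η * G η) ((ck₁.mul hF).circleIntegrable zero_le_one)
      ((ck₂.mul hG).circleIntegrable zero_le_one))
    refine circleAverage_congr_sphere fun η _ => ?_
    simp only [dirichletDatum, phiOne, Complex.real_smul, hk₁, hk₂, ← hc]
    ring
  have hIoo := Ioo_mem_nhdsLT (show (0 : ℝ) < 1 by norm_num)
  have hball : ∀ {s : ℝ}, s ∈ Ioo 0 1 → ∀ {z : ℂ}, ‖z‖ ≤ 1 → (s : ℂ) * z ∈ ball (0 : ℂ) 1 := by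
    intro s hs z hz
    rw [mem_ball_zero_iff, norm_mul, Complex.norm_real, Real.norm_of_nonneg hs.1.le]
    exact (mul_le_of_le_one_right hs.1.le hz).trans_lt hs.2
  have hlim : Tendsto (fun s : ℝ => ‖f (s * a) -
      (circleAverage (fun η => k₁ η * f (s * η)) 0 1 -
        s * circleAverage (fun η => k₂ η * d (s * η)) 0 1)‖) (𝓝[<] 1)
      (𝓝 ‖f a - poissonIntegral (dirichletDatum a fstar φ) a‖) := by
    have e : poissonIntegral (dirichletDatum a fstar φ) a =
        circleAverage (fun η => k₁ η * f η) 0 1 -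
          (1 : ℝ) * circleAverage (fun η => k₂ η * d η) 0 1 := by
      rw [hsplit h.fstar_cont h.φ_cont, Complex.ofReal_one, one_mul]
      congr 1
      · refine circleAverage_congr_sphere fun η hη => ?_
        rw [abs_one] at hη
        simp only [h.boundary_value η hη]
      · refine circleAverage_congr_sphere fun η hη => ?_
        rw [abs_one] at hη
        have : η ∉ ball (0 : ℂ) 1 := by simp_all
        simp only [hd, piecewise_eq_of_notMem _ _ _ this]
    rw [e]
    have hfa : Tendsto (fun s : ℝ => f (s * a)) (𝓝[<] 1) (𝓝 (f a)) := by
      have h1 : ContinuousAt f ((1 : ℝ) * a) := by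
        rw [Complex.ofReal_one, one_mul]
        exact (h.contDiffAt (mem_ball_zero_iff.mpr ha)).continuousAt
      have h2 : ContinuousAt (fun s : ℝ => (s : ℂ) * a) 1 := by fun_prop
      have h3 := (ContinuousAt.comp (f := fun s : ℝ => (s : ℂ) * a) h1 h2).tendsto
      simp only [Function.comp_def, Complex.ofReal_one, one_mul] at h3
      exact h3.mono_left nhdsWithin_le_nhds
    have hs : Tendsto (fun s : ℝ => (s : ℂ)) (𝓝[<] 1) (𝓝 ((1 : ℝ) : ℂ)) :=
      (Complex.continuous_ofReal.tendsto 1).mono_left nhdsWithin_le_nhds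
    exact (hfa.sub ((tendsto_circleAverage_dilation ck₁ h.f_cont).sub
      (hs.mul (tendsto_circleAverage_dilation ck₂ cd)))).norm
  -- The bound is independent of `s`, so it suffices to prove it for each dilate with `0 < s < 1`;
  -- the bilaplacian gains only the factor `s⁴ ≤ 1`.
  refine le_of_tendsto hlim ?_
  filter_upwards [hIoo] with s hs
  have hsm : ∀ z ∈ closedBall (0 : ℂ) 1, ContDiffAt ℝ 4 (fun y => f (s * y)) z := fun z hz =>
    (h.contDiffAt (hball hs (mem_closedBall_zero_iff.mp hz))).comp_mul_left
  have key := norm_sub_poissonIntegral_dirichletDatum_le_of_contDiffAt (K := discSup g) ha hsm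
    fun z hz => by
      have hsz := hball hs (mem_closedBall_zero_iff.mp hz)
      rw [dz_dz_dzbar_dzbar_dilation (h.contDiffAt hsz)]
      have h1 : ‖16 * dz (dz (dzbar (dzbar f))) (s * z)‖ ≤ discSup g := by
        rw [← laplacian_laplacian_eq (h.contDiffAt hsz), h.biharmonic _ hsz]
        exact norm_le_discSup h.g_cont hsz
      rw [norm_mul, Complex.norm_ofNat] at h1
      rw [norm_mul, Complex.conj_ofReal]
      have h2 : ‖(s : ℂ) * s * s * s‖ ≤ 1 := by
        simp only [norm_mul, Complex.norm_real, Real.norm_of_nonneg hs.1.le]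
        have : s * s ≤ 1 := mul_le_one₀ hs.2.le hs.1.le hs.2.le
        exact mul_le_one₀ (mul_le_one₀ this hs.1.le hs.2.le) hs.1.le hs.2.le
      have := mul_le_of_le_one_left (norm_nonneg (dz (dz (dzbar (dzbar f))) (s * z))) h2
      linarith
  have cf : ContinuousOn (fun y => f (s * y)) (sphere 0 1) := fun z hz =>
    (hsm z (sphere_subset_closedBall hz)).continuousAt.continuousWithinAt
  have cdf : ContinuousOn (dzbar fun y => f (s * y)) (sphere 0 1) :=
    continuousOn_dzbar fun z hz => (hsm z (sphere_subset_closedBall hz)).of_le (by norm_num)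
  -- The chain rule for `∂̄` of the dilate supplies the factor `s` already present in `hlim`.
  have e : circleAverage (fun η => k₂ η * dzbar (fun y => f (s * y)) η) 0 1 =
      s * circleAverage (fun η => k₂ η * d (s * η)) 0 1 := by
    rw [← circleAverage_const_mul]
    refine circleAverage_congr_sphere fun η hη => ?_
    have hn : ‖η‖ ≤ 1 := by simp_all
    have hsη := hball hs hn
    have h1 := (hasWirtingerAt_dilation (s := s) (z := η) 1
      ((h.contDiffAt hsη).differentiableAt (by norm_num))).dzbar_eq
    simp only [one_mul, Complex.conj_ofReal] at h1
    simp only [h1, hd, piecewise_eq_of_mem _ _ _ hsη]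
    ring
  rwa [hsplit cf cdf, e] at key

end SolvesBiharmonicDirichlet

/-! ### Assembling the inequality -/

/-- The split comes from `(1 - |a|²)/(1 - āη) = 1 + ā(η - a)/(1 - āη)`, which isolates the harmonic
part `P_F`. -/
theorem poissonIntegral_dirichletDatum {a : ℂ} (ha : ‖a‖ < 1) {F φ : ℂ → ℂ}
    (hF : ContinuousOn F (sphere 0 1)) (hφ : ContinuousOn (phiOne φ) (sphere 0 1)) :
    poissonIntegral (dirichletDatum a F φ) a = poissonIntegral F a +
      poissonIntegral (fun η => conj a * (η - a) / (1 - conj a * η) * F η) a -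
      ((1 - ‖a‖ ^ 2 : ℝ) : ℂ) * poissonIntegral (phiOne φ) a := by
  have hne : ∀ η ∈ sphere (0 : ℂ) 1, 1 - conj a * η ≠ 0 := fun η hη =>
    one_sub_conj_mul_ne_zero ha (mem_sphere_zero_iff_norm.mp hη)
  have c2 : ContinuousOn (fun η => conj a * (η - a) / (1 - conj a * η) * F η) (sphere 0 1) :=
    (ContinuousOn.div (by fun_prop) (by fun_prop) hne).mul hF
  have i1 := circleIntegrable_poissonKernel_smul ha hF
  have i2 := circleIntegrable_poissonKernel_smul ha c2
  have i3 := (circleIntegrable_poissonKernel_smul ha hφ).mul_left ((1 - ‖a‖ ^ 2 : ℝ) : ℂ)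
  simp only [poissonIntegral]
  rw [← circleAverage_add i1 i2, ← circleAverage_const_mul,
    ← circleAverage_fun_sub (i1.add i2) i3]
  refine circleAverage_congr_sphere fun η hη => ?_
  rw [abs_one] at hη
  have := hne η hη
  simp only [dirichletDatum, Pi.add_apply, Complex.real_smul, ← one_sub_mul_conj]
  field_simp
  ring

/-- On the circle `|η - a| = |1 - āη|`, so the multiplier has modulus exactly `|a|`. -/
theorem norm_poissonIntegral_conj_mul_le {a : ℂ} (ha : ‖a‖ < 1) {F : ℂ → ℂ}
    (hF : ContinuousOn F (sphere 0 1)) :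
    ‖poissonIntegral (fun η => conj a * (η - a) / (1 - conj a * η) * F η) a‖ ≤
      discSup (poissonIntegral fun ζ => ‖F ζ‖) * ‖a‖ := by
  have h1 := (le_abs_self _).trans (norm_poissonIntegral_le_discSup ha hF.norm)
  refine le_trans ?_ (mul_le_mul_of_nonneg_right h1 (norm_nonneg a))
  refine (norm_circleAverage_le_circleAverage_norm _).trans_eq ?_
  rw [mul_comm, poissonIntegral, ← smul_eq_mul, ← circleAverage_fun_smul]
  refine circleAverage_congr_sphere fun η hη => ?_
  have hn : ‖η‖ = 1 := by simpa using hη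
  have h0 : ‖1 - conj a * η‖ ≠ 0 := norm_ne_zero_iff.mpr (one_sub_conj_mul_ne_zero ha hn)
  simp only [norm_smul, norm_mul, norm_div, RCLike.norm_conj, norm_sub_of_norm_eq_one hn,
    Real.norm_of_nonneg (poissonKernel_nonneg ha hn), smul_eq_mul]
  field_simp

theorem SolvesBiharmonicDirichlet.schwarzLHS_le_schwarzRHS {g φ fstar f : ℂ → ℂ}
    (h : SolvesBiharmonicDirichlet g φ fstar f) {z : ℂ} (hz : z ∈ closedBall (0 : ℂ) 1) :
    schwarzLHS φ fstar f z ≤ schwarzRHS g φ fstar z := by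
  rw [mem_closedBall_zero_iff] at hz
  rcases hz.lt_or_eq with hz | hz
  · have h1 := h.norm_sub_poissonIntegral_dirichletDatum_le hz
    have h2 := norm_poissonIntegral_sub_le h.fstar_cont hz
    have h3 := norm_poissonIntegral_conj_mul_le hz h.fstar_cont
    have h4 := norm_poissonIntegral_sub_le h.phiOne_cont hz
    have hpos : 0 ≤ 1 - ‖z‖ ^ 2 := by nlinarith [norm_nonneg z]
    rw [poissonIntegral_dirichletDatum hz h.fstar_cont h.phiOne_cont] at h1
    rw [schwarzLHS, schwarzRHS]
    set A := poissonIntegral fstar z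
    set A₀ := poissonIntegral fstar 0
    set B := poissonIntegral (fun η => conj z * (η - z) / (1 - conj z * η) * fstar η) z
    set C := poissonIntegral (phiOne φ) z
    set C₀ := poissonIntegral (phiOne φ) 0
    -- The four groups are the Green potential, the two harmonic Schwarz differences (the second
    -- weighted by `1 - |z|²`) and the multiplier term `B`.
    have e : f z - (((1 - ‖z‖ ^ 2) / (1 + ‖z‖ ^ 2) : ℝ) : ℂ) * A₀
        + (((1 - ‖z‖ ^ 2) ^ 2 / (1 + ‖z‖ ^ 2) : ℝ) : ℂ) * C₀ =
        (f z - (A + B - ((1 - ‖z‖ ^ 2 : ℝ) : ℂ) * C)) +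
          (A - (((1 - ‖z‖ ^ 2) / (1 + ‖z‖ ^ 2) : ℝ) : ℂ) * A₀) + B -
          ((1 - ‖z‖ ^ 2 : ℝ) : ℂ) * (C - (((1 - ‖z‖ ^ 2) / (1 + ‖z‖ ^ 2) : ℝ) : ℂ) * C₀) := by
      push_cast
      ring
    rw [e]
    refine (norm_sub_le _ _).trans ((add_le_add (norm_add₃_le) le_rfl).trans ?_)
    rw [norm_mul, Complex.norm_real, Real.norm_of_nonneg hpos]
    have h5 := mul_le_mul_of_nonneg_left h4 hpos
    calc _ ≤ discSup g / 64 * (1 - ‖z‖ ^ 2) ^ 2 +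
          4 / π * discSup (poissonIntegral fstar) * arctan ‖z‖ +
          discSup (poissonIntegral fun ζ => ‖fstar ζ‖) * ‖z‖ +
          (1 - ‖z‖ ^ 2) * (4 / π * discSup (poissonIntegral (phiOne φ)) * arctan ‖z‖) := by
          gcongr
      _ = _ := by ring
  -- On the circle all factors `1 - |z|²` vanish and `arctan 1 = π/4`, so the first term on the
  -- right already dominates `|f(z)|`.
  · have h1 := norm_le_discSup_poissonIntegral h.fstar_cont hz
    have h2 := discSup_nonneg (poissonIntegral fun ζ => ‖fstar ζ‖)
    rw [← h.boundary_value z (mem_sphere_zero_iff_norm.mpr hz)] at h1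
    have h3 : 4 / π * discSup (poissonIntegral fstar) * (π / 4) =
        discSup (poissonIntegral fstar) := by
      field_simp
    simp only [schwarzLHS, schwarzRHS, hz, arctan_one, h3]
    norm_num
    linarith

/-! ### Sharpness -/

theorem solvesBiharmonicDirichlet_model (M : ℝ) :
    SolvesBiharmonicDirichlet (fun _ => (M : ℂ)) (fun _ => 0) (fun _ => 0)
      (fun z => ((M / 64 * (1 - ‖z‖ ^ 2) ^ 2 : ℝ) : ℂ)) := by
  rw [model_eq]
  have hd : Continuous fun z : ℂ =>
      -2 * ((M / 64 : ℝ) : ℂ) * (z * (1 - z * conj z)) := by fun_prop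
  refine ⟨continuousOn_const, continuousOn_const, (contDiff_model _).contDiffOn,
    (contDiff_model (n := 0) _).continuous.continuousOn, fun z _ => ?_, fun ζ hζ => ?_,
    fun ζ hζ => ?_⟩
  · rw [laplacian_laplacian_eq (contDiff_model _).contDiffAt, dz_dz_dzbar_dzbar_model]
    push_cast
    ring
  · simp [mul_conj_eq_one_of_norm (mem_sphere_zero_iff_norm.mp hζ)]
  · rw [dzbar_model]
    have := hd.tendsto ζ
    simp only [mul_conj_eq_one_of_norm (mem_sphere_zero_iff_norm.mp hζ), sub_self, mul_zero]
      at this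
    exact this.mono_left nhdsWithin_le_nhds

theorem poissonIntegral_fun_zero {E : Type*} [NormedAddCommGroup E] [NormedSpace ℝ E] :
    poissonIntegral (fun _ => (0 : E)) = fun _ => 0 := by
  ext z
  simp [poissonIntegral, circleAverage_def]

theorem discSup_const {E : Type*} [NormedAddCommGroup E] (c : E) :
    discSup (fun _ => c) = ‖c‖ := by
  have : Nonempty (ball (0 : ℂ) 1) := ⟨⟨0, by simp⟩⟩
  exact ciSup_const

theorem schwarzLHS_model_eq {M : ℝ} (hM : 0 < M) (z : ℂ) :
    schwarzLHS (fun _ => 0) (fun _ => 0) (fun z => ((M / 64 * (1 - ‖z‖ ^ 2) ^ 2 : ℝ) : ℂ)) z =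
      schwarzRHS (fun _ => (M : ℂ)) (fun _ => 0) (fun _ => 0) z := by
  have h0 : phiOne (fun _ => 0) = fun _ => 0 := by ext; simp [phiOne]
  simp only [schwarzLHS, schwarzRHS, h0, norm_zero, poissonIntegral_fun_zero, discSup_const,
    mul_zero, sub_zero, add_zero, zero_mul, zero_div, zero_add, Complex.norm_real]
  rw [Real.norm_of_nonneg (by positivity), Real.norm_of_nonneg hM.le]
  ring

end

/-- Schwarz type inequality for the inhomogeneous biharmonic Dirichlet problem in the unit disk,
together with its sharpness: for `g ≡ M > 0` the function `f(z) = M (1 - |z|²)² / 64` is a solution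
(with zero boundary data) for which equality holds at every point of the closed disk. -/
theorem theorem1 :
    (∀ g φ fstar f : ℂ → ℂ, SolvesBiharmonicDirichlet g φ fstar f →
      ∀ z ∈ closedBall (0 : ℂ) 1, schwarzLHS φ fstar f z ≤ schwarzRHS g φ fstar z) ∧
    (∀ M : ℝ, 0 < M →
      SolvesBiharmonicDirichlet (fun _ => (M : ℂ)) (fun _ => 0) (fun _ => 0)
        (fun z => ((M / 64 * (1 - ‖z‖ ^ 2) ^ 2 : ℝ) : ℂ)) ∧
      ∀ z ∈ closedBall (0 : ℂ) 1,
        schwarzLHS (fun _ => 0) (fun _ => 0)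
            (fun z => ((M / 64 * (1 - ‖z‖ ^ 2) ^ 2 : ℝ) : ℂ)) z =
          schwarzRHS (fun _ => (M : ℂ)) (fun _ => 0) (fun _ => 0) z) := by
  exact ⟨fun _ _ _ _ h _ hz => h.schwarzLHS_le_schwarzRHS hz,
    fun M hM => ⟨solvesBiharmonicDirichlet_model M, fun z _ => schwarzLHS_model_eq hM z⟩⟩
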